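/- Let $M$ be a paracompact Hausdorff smooth manifold and let $\mathscr{G}$ be a Hausdorff paracompact Lie groupoid over $M$ (a groupoid with objects $M$ whose arrows form a smooth manifold, such that all structure maps are smooth and the source and target maps $s,t:\mathscr{G}\to M$ are submersions). For $x\in M$ write $1_x$ for the unit arrow at $x$ and $\mathscr{G}(x,-)=s^{-1}(x)$; the product $gh$ is defined if $s(g)=t(h)$. Let $\mathfrak{g}$ be the Lie algebroid of $\mathscr{G}$, the pull-back of $\ker(dt)$ along the unit map $M\to\mathscr{G}$. A section $X\in\Gamma\mathfrak{g}$ determines the left-invariant vector field $\bar X$ on $\mathscr{G}$, $\bar X_g=dL_g(X_{s(g)})$, where $L_g:t^{-1}(s(g))\to t^{-1}(t(g))$, $L_g(h)=gh$; the bracket of $\Gamma\mathfrak{g}$ is the one for which $\overline{[X,Y]}=[\bar X,\bar Y]$, and the anchor is the restriction of $ds$, so that $X(f)(x)=df(ds(X_x))$ for $f\in C^\infty(M)$. Let $\mathcal{U}(\mathfrak{g})$ be the universal enveloping algebra of the Lie-Rinehart algebra $(C^\infty(M),\Gamma\mathfrak{g})$ over $\mathbb{R}$, and let $$\Omega:\mathcal{U}(\mathfrak{g})\to\mathrm{End}(C^\infty(\mathscr{G}))$$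 be the homomorphism of algebras which maps $f\in C^\infty(M)$ to the multiplication by $f\circ s$ and $X\in\Gamma\mathfrak{g}$ to the derivation $\bar X$; its image is the algebra of left-invariant differential operators on $\mathscr{G}$. For $x\in M$ let $N_x$ be the ideal of the functions in $C^\infty(M)$ with zero germ at $x$, and let $\mathcal{U}(\mathfrak{g})_x=\mathcal{U}(\mathfrak{g})/N_x\,\mathcal{U}(\mathfrak{g})$ be the localization of $\mathcal{U}(\mathfrak{g})$ at $x$; as $N_x\,\mathcal{U}(\mathfrak{g})$ is a two-sided ideal, this is an algebra. Write $u_x\in\mathcal{U}(\mathfrak{g})_x$ for the class of $u\in\mathcal{U}(\mathfrak{g})$. For $g\in\mathscr{G}$ let $C^\infty(\mathscr{G})_g$ be the algebra of germs at $g$ of functions in $C^\infty(\mathscr{G})$, the quotient of $C^\infty(\mathscr{G})$ by the ideal of functions with zero germ at $g$, and write $F_g$ for the germ of $F$. Then for any $x\in M$ and any $g\in\mathscr{G}(x,-)$ the formula $$u_x[F_g]=(\Omega(u)(F))_g,\qquad u\in\mathcal{U}(\mathfrak{g}),\ F\in C^\infty(\mathscr{G}),$$ gives a well-defined action $\mathcal{U}(\mathfrak{g})_x\times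 C^\infty(\mathscr{G})_g\to C^\infty(\mathscr{G})_g$: there is exactly one homomorphism of unital $\mathbb{R}$-algebras $\rho:\mathcal{U}(\mathfrak{g})_x\to\mathrm{End}_{\mathbb{R}}(C^\infty(\mathscr{G})_g)$ such that $\rho(u_x)(F_g)=(\Omega(u)(F))_g$ for all $u\in\mathcal{U}(\mathfrak{g})$ and all $F\in C^\infty(\mathscr{G})$. -/

import Mathlib

open scoped Manifold ContDiff Topology

set_option linter.unusedSectionVars false

namespace LieRinehart

variable (k A L : Type*) [CommRing k] [CommRing A] [LieRing L] [Algebra k A] [LieAlgebra k L]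
  [Module A L] [LieRingModule L A]

/-- The defining relations of the universal enveloping algebra, on the free algebra generated by
the elements `a ∈ A` and `X ∈ L`. -/
inductive EnvRel : FreeAlgebra k (A ⊕ L) → FreeAlgebra k (A ⊕ L) → Prop
  | alg_add (a b : A) : EnvRel (.ι k (.inl (a + b))) (.ι k (.inl a) + .ι k (.inl b))
  | alg_mul (a b : A) : EnvRel (.ι k (.inl (a * b))) (.ι k (.inl a) * .ι k (.inl b))
  | alg_scalar (c : k) : EnvRel (.ι k (.inl (algebraMap k A c))) (algebraMap k _ c)
  | lie_add (X Y : L) : EnvRel (.ι k (.inr (X + Y))) (.ι k (.inr X) + .ι k (.inr Y))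
  | lie_smul (c : k) (X : L) : EnvRel (.ι k (.inr (c • X))) (c • .ι k (.inr X))
  | lie_lie (X Y : L) : EnvRel (.ι k (.inr ⁅X, Y⁆))
      (.ι k (.inr X) * .ι k (.inr Y) - .ι k (.inr Y) * .ι k (.inr X))
  | smul (a : A) (X : L) : EnvRel (.ι k (.inr (a • X))) (.ι k (.inl a) * .ι k (.inr X))
  | anchor (X : L) (a : A) : EnvRel (.ι k (.inl ⁅X, a⁆))
      (.ι k (.inr X) * .ι k (.inl a) - .ι k (.inl a) * .ι k (.inr X))

/-- The universal enveloping algebra `𝓤(A, L)` of a `(k, A)`-Lie algebra `L`, with anchor written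
`X(a) = ⁅X, a⁆`. -/
def Env : Type _ := RingQuot (EnvRel k A L)

namespace Env

noncomputable instance : Ring (Env k A L) := inferInstanceAs (Ring (RingQuot (EnvRel k A L)))
noncomputable instance : Algebra k (Env k A L) :=
  inferInstanceAs (Algebra k (RingQuot (EnvRel k A L)))

/-- The quotient map from the free algebra. -/
noncomputable def mk : FreeAlgebra k (A ⊕ L) →ₐ[k] Env k A L := RingQuot.mkAlgHom k (EnvRel k A L)

variable {A L} in
theorem mk_rel {a b : FreeAlgebra k (A ⊕ L)} (h : EnvRel k A L a b) : mk k A L a = mk k A L b :=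
  RingQuot.mkAlgHom_rel k h

/-- The canonical algebra homomorphism `ι_A : A → 𝓤(A, L)`. -/
noncomputable def ofAlg : A →ₐ[k] Env k A L :=
  AlgHom.ofLinearMap
    { toFun := fun a => mk k A L (.ι k (.inl a))
      map_add' := fun a b => by rw [mk_rel k (.alg_add a b), map_add]
      map_smul' := fun c a => by
        rw [Algebra.smul_def, mk_rel k (.alg_mul _ a), map_mul, mk_rel k (.alg_scalar c),
          AlgHom.commutes, RingHom.id_apply, Algebra.smul_def] }
    (by
      change mk k A L (.ι k (.inl 1)) = 1
      rw [← map_one (algebraMap k A), mk_rel k (.alg_scalar 1), map_one, map_one])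
    (fun a b => by
      change mk k A L (.ι k (.inl (a * b))) = mk k A L (.ι k (.inl a)) * mk k A L (.ι k (.inl b))
      rw [mk_rel k (.alg_mul a b), map_mul])

/-- The canonical homomorphism of Lie algebras `ι_L : L → 𝓤(A, L)`, as a linear map. -/
noncomputable def ofLie : L →ₗ[k] Env k A L where
  toFun X := mk k A L (.ι k (.inr X))
  map_add' X Y := by rw [mk_rel k (.lie_add X Y), map_add]
  map_smul' c X := by rw [mk_rel k (.lie_smul c X), map_smul, RingHom.id_apply]

variable {k A L}

theorem ofLie_lie (X Y : L) : ofLie k A L ⁅X, Y⁆ =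
    ofLie k A L X * ofLie k A L Y - ofLie k A L Y * ofLie k A L X := by
  change mk k A L _ = mk k A L _ * mk k A L _ - mk k A L _ * mk k A L _
  rw [mk_rel k (.lie_lie X Y), map_sub, map_mul, map_mul]

theorem ofLie_smul (a : A) (X : L) : ofLie k A L (a • X) = ofAlg k A L a * ofLie k A L X := by
  change mk k A L _ = mk k A L _ * mk k A L _
  rw [mk_rel k (.smul a X), map_mul]

theorem ofAlg_lie (X : L) (a : A) : ofAlg k A L ⁅X, a⁆ =
    ofLie k A L X * ofAlg k A L a - ofAlg k A L a * ofLie k A L X := by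
  change mk k A L _ = mk k A L _ * mk k A L _ - mk k A L _ * mk k A L _
  rw [mk_rel k (.anchor X a), map_sub, map_mul, map_mul]

/-- The universal property of `𝓤(A, L)`: existence. -/
noncomputable def lift {B : Type*} [Ring B] [Algebra k B] (κA : A →ₐ[k] B) (κL : L →ₗ[k] B)
    (hlie : ∀ X Y, κL ⁅X, Y⁆ = κL X * κL Y - κL Y * κL X)
    (hsmul : ∀ (a : A) X, κL (a • X) = κA a * κL X)
    (hanchor : ∀ X (a : A), κA ⁅X, a⁆ = κL X * κA a - κA a * κL X) : Env k A L →ₐ[k] B :=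
  RingQuot.liftAlgHom k ⟨FreeAlgebra.lift k (Sum.elim κA κL), by
    rintro _ _ (_ | _ | _ | _ | _ | _ | _ | _) <;>
      simp [hlie, hsmul, hanchor]⟩

section lift
variable {B : Type*} [Ring B] [Algebra k B] {κA : A →ₐ[k] B} {κL : L →ₗ[k] B}
    {hlie : ∀ X Y, κL ⁅X, Y⁆ = κL X * κL Y - κL Y * κL X}
    {hsmul : ∀ (a : A) X, κL (a • X) = κA a * κL X}
    {hanchor : ∀ X (a : A), κA ⁅X, a⁆ = κL X * κA a - κA a * κL X}

theorem lift_ofAlg (a : A) : lift κA κL hlie hsmul hanchor (ofAlg k A L a) = κA a := by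
  change RingQuot.liftAlgHom k _ (RingQuot.mkAlgHom k _ _) = _
  simp

theorem lift_ofLie (X : L) : lift κA κL hlie hsmul hanchor (ofLie k A L X) = κL X := by
  change RingQuot.liftAlgHom k _ (RingQuot.mkAlgHom k _ _) = _
  simp

end lift

/-- The universal property of `𝓤(A, L)`: uniqueness. -/
theorem hom_ext {B : Type*} [Ring B] [Algebra k B] {φ ψ : Env k A L →ₐ[k] B}
    (hA : ∀ a, φ (ofAlg k A L a) = ψ (ofAlg k A L a))
    (hL : ∀ X, φ (ofLie k A L X) = ψ (ofLie k A L X)) : φ = ψ := by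
  apply RingQuot.ringQuot_ext'
  apply FreeAlgebra.hom_ext
  funext i
  rcases i with a | X
  exacts [hA a, hL X]

theorem induction {P : Env k A L → Prop} (hA : ∀ a, P (ofAlg k A L a))
    (hL : ∀ X, P (ofLie k A L X)) (hadd : ∀ u v, P u → P v → P (u + v))
    (hmul : ∀ u v, P u → P v → P (u * v)) (u : Env k A L) : P u := by
  obtain ⟨w, rfl⟩ := RingQuot.mkAlgHom_surjective k (EnvRel k A L) u
  induction w using FreeAlgebra.induction with
  | grade0 c =>
    have := hA (algebraMap k A c)
    rw [AlgHom.commutes] at this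
    rw [AlgHom.commutes]; exact this
  | grade1 i => rcases i with a | X; exacts [hA a, hL X]
  | mul a b ha hb => rw [map_mul]; exact hmul _ _ ha hb
  | add a b ha hb => rw [map_add]; exact hadd _ _ ha hb

/-- `A` acts on `𝓤(A, L)` from the left. -/
noncomputable instance : Module A (Env k A L) := Module.compHom _ (ofAlg k A L : A →+* Env k A L)

theorem smul_def (a : A) (u : Env k A L) : a • u = ofAlg k A L a * u := rfl

/-- For an ideal `N` of `A` which is stable under the anchor, the submodule `N𝓤` of `𝓤 = 𝓤(A, L)`
is a left ideal. -/
theorem mul_mem_smul_top {N : Ideal A} (hN : ∀ (X : L), ∀ a ∈ N, ⁅X, a⁆ ∈ N) (u v : Env k A L)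
    (hv : v ∈ N • (⊤ : Submodule A (Env k A L))) : u * v ∈ N • (⊤ : Submodule A (Env k A L)) := by
  induction u using induction generalizing v with
  | hA a => exact Submodule.smul_mem _ a hv
  | hL X =>
    induction hv using Submodule.smul_induction_on' with
    | smul a ha w _ =>
      have : ofLie k A L X * (a • w) = a • (ofLie k A L X * w) + ⁅X, a⁆ • w := by
        simp only [smul_def, ofAlg_lie]; noncomm_ring
      rw [this]
      exact add_mem (Submodule.smul_mem_smul ha trivial) (Submodule.smul_mem_smul (hN X a ha) trivial)
    | add _ _ _ _ h1 h2 => rw [mul_add]; exact add_mem h1 h2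
  | hadd a b ha hb => rw [add_mul]; exact add_mem (ha v hv) (hb v hv)
  | hmul a b ha hb => rw [mul_assoc]; exact ha _ (hb v hv)

variable (k L) in
/-- The submodule `N𝓤` of `𝓤 = 𝓤(A, L)`, for an ideal `N` of `A` stable under the anchor. -/
def smulIdeal (N : Ideal A) (hN : ∀ (X : L), ∀ a ∈ N, ⁅X, a⁆ ∈ N) : Ideal (Env k A L) where
  carrier := (N • (⊤ : Submodule A (Env k A L)) : Submodule A (Env k A L))
  add_mem' := add_mem
  zero_mem' := zero_mem _
  smul_mem' u v hv := mul_mem_smul_top hN u v hv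

instance (N : Ideal A) (hN : ∀ (X : L), ∀ a ∈ N, ⁅X, a⁆ ∈ N) :
    (smulIdeal k L N hN).IsTwoSided where
  mul_mem_of_left {u} v hu := by
    change u * v ∈ N • (⊤ : Submodule A (Env k A L))
    change u ∈ N • (⊤ : Submodule A (Env k A L)) at hu
    induction hu using Submodule.smul_induction_on' with
    | smul a ha w _ =>
      rw [smul_def, mul_assoc]
      exact Submodule.smul_mem_smul (n := w * v) ha trivial
    | add _ _ _ _ h1 h2 => rw [add_mul]; exact add_mem h1 h2

end Env
end LieRinehart

namespace LieGroupoid.Aux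

open Set Filter

variable {E₀ : Type*} [NormedAddCommGroup E₀] [NormedSpace ℝ E₀]
  {M : Type*} [TopologicalSpace M] [ChartedSpace E₀ M]
  {E₁ : Type*} [NormedAddCommGroup E₁] [NormedSpace ℝ E₁]
  {G : Type*} [TopologicalSpace G] [ChartedSpace E₁ G]

/-- Every local smooth function extends, near a point, to a global smooth function. -/
theorem exists_extend [FiniteDimensional ℝ E₁] [IsManifold 𝓘(ℝ, E₁) ∞ G] [T2Space G]
    {f : G → ℝ} {p : G}
    (hf : ∀ᶠ q in 𝓝 p, ContMDiffAt 𝓘(ℝ, E₁) 𝓘(ℝ) ∞ f q) :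
    ∃ F : C^∞⟮𝓘(ℝ, E₁), G; ℝ⟯, (F : G → ℝ) =ᶠ[𝓝 p] f := by
  obtain ⟨χ, -, hχ⟩ := (SmoothBumpFunction.nhds_basis_tsupport (I := 𝓘(ℝ, E₁)) p).mem_iff.1 hf
  refine ⟨⟨fun q => χ q * f q, ?_⟩, ?_⟩
  · apply contMDiff_of_tsupport
    intro q hq
    have hq' : q ∈ tsupport χ := tsupport_mul_subset_left hq
    exact χ.contMDiffAt.mul (hχ hq')
  · filter_upwards [χ.eventuallyEq_one] with q hq
    simp [hq]

theorem mfderiv_eq_of_eventuallyEq {f h : G → ℝ} {p : G} (e : f =ᶠ[𝓝 p] h)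
    (v : TangentSpace 𝓘(ℝ, E₁) p) :
    (mfderiv 𝓘(ℝ, E₁) 𝓘(ℝ) f p v : ℝ) = mfderiv 𝓘(ℝ, E₁) 𝓘(ℝ) h p v := by
  rw [e.mfderiv_eq]
  rfl

theorem extChart_injective [IsManifold 𝓘(ℝ, E₁) ∞ G] (p : G) :
    Function.Injective (mfderiv 𝓘(ℝ, E₁) 𝓘(ℝ, E₁) (extChartAt 𝓘(ℝ, E₁) p) p) := by
  have : IsManifold 𝓘(ℝ, E₁) 1 G := .of_le (n := ∞) (by simp)
  obtain ⟨e, he⟩ := isInvertible_mfderiv_extChartAt (I := 𝓘(ℝ, E₁)) (mem_extChartAt_source p)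
  rw [← he]; exact e.injective

/-- Tangent vectors are separated by smooth functions. -/
theorem tangent_ext [FiniteDimensional ℝ E₁] [IsManifold 𝓘(ℝ, E₁) ∞ G] [T2Space G] {p : G}
    {v w : TangentSpace 𝓘(ℝ, E₁) p}
    (h : ∀ F : C^∞⟮𝓘(ℝ, E₁), G; ℝ⟯, (mfderiv 𝓘(ℝ, E₁) 𝓘(ℝ) F p v : ℝ) =
      mfderiv 𝓘(ℝ, E₁) 𝓘(ℝ) F p w) : v = w := by
  apply extChart_injective p
  refine (SeparatingDual.eq_iff_forall_dual_eq (R := ℝ) (V := E₁)).2 fun ℓ => ?_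
  have hs : ∀ᶠ q in 𝓝 p, ContMDiffAt 𝓘(ℝ, E₁) 𝓘(ℝ) ∞ (ℓ ∘ extChartAt 𝓘(ℝ, E₁) p) q := by
    filter_upwards [chart_source_mem_nhds E₁ p] with q hq
    exact ℓ.contMDiff.contMDiffAt.comp q (contMDiffAt_extChartAt' hq)
  obtain ⟨F, hF⟩ := exists_extend hs
  have key : ∀ u : TangentSpace 𝓘(ℝ, E₁) p, (mfderiv 𝓘(ℝ, E₁) 𝓘(ℝ) F p u : ℝ) =
      ℓ (mfderiv 𝓘(ℝ, E₁) 𝓘(ℝ, E₁) (extChartAt 𝓘(ℝ, E₁) p) p u) := by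
    intro u
    rw [mfderiv_eq_of_eventuallyEq hF]
    have h1 : MDifferentiableAt 𝓘(ℝ, E₁) 𝓘(ℝ, E₁) (extChartAt 𝓘(ℝ, E₁) p) p :=
      (contMDiffAt_extChartAt (n := ∞)).mdifferentiableAt (by simp)
    have h2 : HasMFDerivAt 𝓘(ℝ, E₁) 𝓘(ℝ) ℓ (extChartAt 𝓘(ℝ, E₁) p p) ℓ :=
      ℓ.hasFDerivAt.hasMFDerivAt
    rw [(h2.comp p h1.hasMFDerivAt).mfderiv]
    rfl
  have := h F
  rw [key, key] at this
  exact this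

/-- Near a point, a submersion `t` has a smooth family of retractions `ρ y` onto the fibres
`t ⁻¹' {y}`. -/
theorem exists_retraction {t : G → M} {p : G}
    (ht : Manifold.IsSubmersionAt 𝓘(ℝ, E₁) 𝓘(ℝ, E₀) ∞ t p) :
    ∃ (ρ : M × G → G) (W : Set (M × G)), IsOpen W ∧ (t p, p) ∈ W ∧
      ContMDiffOn (𝓘(ℝ, E₀).prod 𝓘(ℝ, E₁)) 𝓘(ℝ, E₁) ∞ ρ W ∧
      (∀ w ∈ W, t (ρ w) = w.1) ∧ (∀ h, (t h, h) ∈ W → ρ (t h, h) = h) := by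
  set φ := ht.domChart.extend 𝓘(ℝ, E₁) with hφ
  set ψ := ht.codChart.extend 𝓘(ℝ, E₀) with hψ
  have hφs : φ.source = ht.domChart.source := ht.domChart.extend_source
  have hψs : ψ.source = ht.codChart.source := ht.codChart.extend_source
  have hφo : IsOpen φ.source := hφs ▸ ht.domChart.open_source
  have hψo : IsOpen ψ.source := hψs ▸ ht.codChart.open_source
  have hφt : IsOpen φ.target := ht.domChart.isOpen_extend_target
  set e := ht.equiv
  have hw : ∀ h ∈ φ.source, ψ (t h) = (e (φ h)).1 := fun h hh => by
    have := ht.writtenInCharts (φ.map_source hh)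
    simp only [Function.comp] at this
    rw [← hφ, φ.left_inv hh] at this
    exact this
  let β : M × G → E₁ := fun w => e.symm (ψ w.1, (e (φ w.2)).2)
  have hβ : ContMDiffOn (𝓘(ℝ, E₀).prod 𝓘(ℝ, E₁)) 𝓘(ℝ, E₁) ∞ β (ψ.source ×ˢ φ.source) := by
    have h1 : ContMDiffOn (𝓘(ℝ, E₀).prod 𝓘(ℝ, E₁)) 𝓘(ℝ, E₀) ∞ (fun w : M × G => ψ w.1)
        (ψ.source ×ˢ φ.source) := by
      refine (ht.codChart.contMDiffOn_extend ht.codChart_mem_maximalAtlas).comp contMDiffOn_fst ?_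
      intro w hw; rw [hψs] at hw; exact hw.1
    have h2 : ContMDiffOn (𝓘(ℝ, E₀).prod 𝓘(ℝ, E₁)) 𝓘(ℝ, E₁) ∞ (fun w : M × G => φ w.2)
        (ψ.source ×ˢ φ.source) := by
      refine (ht.domChart.contMDiffOn_extend ht.domChart_mem_maximalAtlas).comp contMDiffOn_snd ?_
      intro w hw; rw [hφs] at hw; exact hw.2
    have h3 := ((ContinuousLinearMap.snd ℝ E₀ ht.complement).comp
      (e : E₁ →L[ℝ] E₀ × ht.complement)).contMDiff (n := ∞) |>.comp_contMDiffOn h2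
    exact (e.symm : E₀ × ht.complement →L[ℝ] E₁).contMDiff.comp_contMDiffOn (h1.prodMk_space h3)
  refine ⟨φ.symm ∘ β, (ψ.source ×ˢ φ.source) ∩ β ⁻¹' φ.target,
    hβ.continuousOn.isOpen_inter_preimage (hψo.prod hφo) hφt, ?_, ?_, ?_, ?_⟩
  · have hp : p ∈ φ.source := hφs ▸ ht.mem_domChart_source
    refine ⟨⟨hψs ▸ ht.mem_codChart_source, hp⟩, ?_⟩
    change e.symm (ψ (t p), (e (φ p)).2) ∈ φ.target
    rw [hw p hp]
    simpa using φ.map_source hp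
  · refine (contMDiffOn_extend_symm ht.domChart_mem_maximalAtlas).comp
      (hβ.mono inter_subset_left) ?_
    intro w hw
    have := hw.2
    simpa [hφ] using this
  · rintro ⟨y, h⟩ ⟨⟨hy, hh⟩, hβw⟩
    have hm : φ.symm (β (y, h)) ∈ φ.source := φ.map_target hβw
    have h1 := hw _ hm
    rw [φ.right_inv hβw] at h1
    have h2 : (e (β (y, h))).1 = ψ y := by simp [β]
    rw [h2] at h1
    refine ψ.injOn ?_ hy h1
    rw [hψs]
    rw [hφs] at hm
    exact ht.source_subset_preimage_source hm
  · rintro h ⟨⟨-, hh⟩, -⟩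
    change φ.symm (e.symm (ψ (t h), (e (φ h)).2)) = h
    rw [hw h hh]
    simpa using φ.left_inv hh

end LieGroupoid.Aux

namespace LieGroupoid.Aux

open Set Filter VectorField

variable {E₁ : Type*} [NormedAddCommGroup E₁] [NormedSpace ℝ E₁]
  {G : Type*} [TopologicalSpace G] [ChartedSpace E₁ G]

/-- A vector field acting on a function. -/
noncomputable def act (V : ∀ g : G, TangentSpace 𝓘(ℝ, E₁) g) (F : G → ℝ) (g : G) : ℝ :=
  mfderiv 𝓘(ℝ, E₁) 𝓘(ℝ) F g (V g)

/-- A vector field read in a chart. -/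
noncomputable def inChart (V : ∀ g : G, TangentSpace 𝓘(ℝ, E₁) g) (x : G) : E₁ → E₁ :=
  mpullbackWithin 𝓘(ℝ, E₁) 𝓘(ℝ, E₁) (extChartAt 𝓘(ℝ, E₁) x).symm V (range 𝓘(ℝ, E₁))

/-- The derivative of the inverse of a chart. -/
noncomputable def symmDeriv (x : G) (z : E₁) :
    E₁ →L[ℝ] TangentSpace 𝓘(ℝ, E₁) ((extChartAt 𝓘(ℝ, E₁) x).symm z) :=
  mfderivWithin 𝓘(ℝ, E₁) 𝓘(ℝ, E₁) (extChartAt 𝓘(ℝ, E₁) x).symm (range 𝓘(ℝ, E₁)) z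

theorem fderiv_comp_extChartAt_symm [IsManifold 𝓘(ℝ, E₁) ∞ G] {x : G} {z : E₁}
    (hz : z ∈ (extChartAt 𝓘(ℝ, E₁) x).target) {F : G → ℝ}
    (hF : MDifferentiableAt 𝓘(ℝ, E₁) 𝓘(ℝ) F ((extChartAt 𝓘(ℝ, E₁) x).symm z)) (v : E₁) :
    fderiv ℝ (F ∘ (extChartAt 𝓘(ℝ, E₁) x).symm) z v =
      mfderiv 𝓘(ℝ, E₁) 𝓘(ℝ) F ((extChartAt 𝓘(ℝ, E₁) x).symm z) (symmDeriv x z v) := by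
  have : IsManifold 𝓘(ℝ, E₁) 1 G := .of_le (n := ∞) (by simp)
  have h := mdifferentiableWithinAt_extChartAt_symm (I := 𝓘(ℝ, E₁)) hz
  have h2 : HasMFDerivWithinAt 𝓘(ℝ, E₁) 𝓘(ℝ) _ _ _ _ :=
    hF.hasMFDerivAt.comp_hasMFDerivWithinAt z h.hasMFDerivWithinAt
  have h3 : HasFDerivWithinAt (F ∘ (extChartAt 𝓘(ℝ, E₁) x).symm)
    ((mfderiv 𝓘(ℝ, E₁) 𝓘(ℝ) F ((extChartAt 𝓘(ℝ, E₁) x).symm z) ∘L symmDeriv x z :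
      E₁ →L[ℝ] ℝ)) (range 𝓘(ℝ, E₁)) z := hasMFDerivWithinAt_iff_hasFDerivWithinAt.1 h2
  rw [modelWithCornersSelf_coe, range_id] at h3
  exact DFunLike.congr_fun (hasFDerivWithinAt_univ.1 h3).fderiv v

theorem symmDeriv_inChart [IsManifold 𝓘(ℝ, E₁) ∞ G] {x : G} {z : E₁}
    (hz : z ∈ (extChartAt 𝓘(ℝ, E₁) x).target) (V : ∀ g : G, TangentSpace 𝓘(ℝ, E₁) g) :
    symmDeriv x z (inChart V x z) = V ((extChartAt 𝓘(ℝ, E₁) x).symm z) := by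
  have : IsManifold 𝓘(ℝ, E₁) 1 G := .of_le (n := ∞) (by simp)
  have h := isInvertible_mfderivWithin_extChartAt_symm (I := 𝓘(ℝ, E₁)) hz
  obtain ⟨e, he⟩ := h
  have h1 : inChart V x z = e.symm (V ((extChartAt 𝓘(ℝ, E₁) x).symm z)) := by
    rw [inChart, mpullbackWithin_apply, ← he, ContinuousLinearMap.inverse_equiv]; rfl
  rw [h1, symmDeriv, ← he]
  exact e.apply_symm_apply _

theorem act_comp_symm [IsManifold 𝓘(ℝ, E₁) ∞ G] {x : G} {z : E₁}
    (hz : z ∈ (extChartAt 𝓘(ℝ, E₁) x).target) {F : G → ℝ}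
    (hF : MDifferentiableAt 𝓘(ℝ, E₁) 𝓘(ℝ) F ((extChartAt 𝓘(ℝ, E₁) x).symm z))
    (V : ∀ g : G, TangentSpace 𝓘(ℝ, E₁) g) :
    fderiv ℝ (F ∘ (extChartAt 𝓘(ℝ, E₁) x).symm) z (inChart V x z) =
      act V F ((extChartAt 𝓘(ℝ, E₁) x).symm z) := by
  rw [fderiv_comp_extChartAt_symm hz hF, symmDeriv_inChart hz, act]

theorem symmDeriv_lieBracket [IsManifold 𝓘(ℝ, E₁) ∞ G] (x : G)
    (V W : ∀ g : G, TangentSpace 𝓘(ℝ, E₁) g) :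
    (⟨(extChartAt 𝓘(ℝ, E₁) x).symm (extChartAt 𝓘(ℝ, E₁) x x),
      symmDeriv x (extChartAt 𝓘(ℝ, E₁) x x)
        (lieBracket ℝ (inChart V x) (inChart W x) (extChartAt 𝓘(ℝ, E₁) x x))⟩ :
      TangentBundle 𝓘(ℝ, E₁) G) =
    ⟨x, mlieBracket 𝓘(ℝ, E₁) V W x⟩ := by
  have : IsManifold 𝓘(ℝ, E₁) 1 G := .of_le (n := ∞) (by simp)
  set w : E₁ := lieBracket ℝ (inChart V x) (inChart W x) (extChartAt 𝓘(ℝ, E₁) x x) with hw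
  have hb : mlieBracket 𝓘(ℝ, E₁) V W x =
      (mfderiv 𝓘(ℝ, E₁) 𝓘(ℝ, E₁) (extChartAt 𝓘(ℝ, E₁) x) x).inverse w := by
    rw [← mlieBracketWithin_univ, mlieBracketWithin_apply, hw, ← lieBracketWithin_univ]
    have hu : (extChartAt 𝓘(ℝ, E₁) x).symm ⁻¹' univ ∩ range 𝓘(ℝ, E₁) = univ := by simp
    rw [hu]; rfl
  rw [hb]
  have hz : extChartAt 𝓘(ℝ, E₁) x x ∈ (extChartAt 𝓘(ℝ, E₁) x).target := mem_extChartAt_target x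
  have hx : x = (extChartAt 𝓘(ℝ, E₁) x).symm (extChartAt 𝓘(ℝ, E₁) x x) :=
    (extChartAt_to_inv x).symm
  generalize extChartAt 𝓘(ℝ, E₁) x x = z at hz hx
  have aux : ∀ y : G, y = (extChartAt 𝓘(ℝ, E₁) x).symm z →
      (⟨(extChartAt 𝓘(ℝ, E₁) x).symm z, symmDeriv x z w⟩ : TangentBundle 𝓘(ℝ, E₁) G) =
      ⟨y, (mfderiv 𝓘(ℝ, E₁) 𝓘(ℝ, E₁) (extChartAt 𝓘(ℝ, E₁) x) y).inverse w⟩ := by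
    rintro y rfl
    have h := ContinuousLinearMap.inverse_eq
      (mfderiv_extChartAt_comp_mfderivWithin_extChartAt_symm (I := 𝓘(ℝ, E₁)) hz)
      (mfderivWithin_extChartAt_symm_comp_mfderiv_extChartAt (I := 𝓘(ℝ, E₁)) hz)
    exact congrArg (fun v => (⟨(extChartAt 𝓘(ℝ, E₁) x).symm z, v⟩ : TangentBundle 𝓘(ℝ, E₁) G))
      (DFunLike.congr_fun h.symm w)
  exact aux x hx

theorem lieBracket_second {E : Type*} [NormedAddCommGroup E] [NormedSpace ℝ E] {F : E → ℝ}
    {V W : E → E} {z : E} (hF : ContDiffAt ℝ 2 F z) (dV : DifferentiableAt ℝ V z)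
    (dW : DifferentiableAt ℝ W z) :
    fderiv ℝ F z (lieBracket ℝ V W z) =
      fderiv ℝ (fun y => fderiv ℝ F y (W y)) z (V z) -
      fderiv ℝ (fun y => fderiv ℝ F y (V y)) z (W z) := by
  have dd : DifferentiableAt ℝ (fderiv ℝ F) z :=
    (hF.fderiv_right (m := 1) (by norm_num)).differentiableAt (by simp)
  have hsymm : IsSymmSndFDerivAt ℝ F z := hF.isSymmSndFDerivAt (by simp)
  rw [fderiv_clm_apply dd dW, fderiv_clm_apply dd dV, lieBracket]
  simp only [map_sub, add_apply, ContinuousLinearMap.comp_apply,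
    ContinuousLinearMap.flip_apply]
  rw [hsymm.eq]
  ring

/-- The Lie bracket of vector fields is the commutator of derivations. -/
theorem act_mlieBracket [FiniteDimensional ℝ E₁] [IsManifold 𝓘(ℝ, E₁) ∞ G]
    {V W : ∀ g : G, TangentSpace 𝓘(ℝ, E₁) g} {F : G → ℝ}
    (hV : ContMDiff 𝓘(ℝ, E₁) 𝓘(ℝ, E₁).tangent ∞ (fun g => (⟨g, V g⟩ : TangentBundle 𝓘(ℝ, E₁) G)))
    (hW : ContMDiff 𝓘(ℝ, E₁) 𝓘(ℝ, E₁).tangent ∞ (fun g => (⟨g, W g⟩ : TangentBundle 𝓘(ℝ, E₁) G)))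
    (hF : ContMDiff 𝓘(ℝ, E₁) 𝓘(ℝ) ∞ F)
    (hVF : ContMDiff 𝓘(ℝ, E₁) 𝓘(ℝ) ∞ (act V F)) (hWF : ContMDiff 𝓘(ℝ, E₁) 𝓘(ℝ) ∞ (act W F))
    (x : G) :
    act (mlieBracket 𝓘(ℝ, E₁) V W) F x = act V (act W F) x - act W (act V F) x := by
  have i1 : IsManifold 𝓘(ℝ, E₁) 1 G := .of_le (n := ∞) (by simp)
  have i2 : IsManifold 𝓘(ℝ, E₁) 2 G := .of_le (n := ∞) (WithTop.coe_le_coe.2 (le_top : (2 : ℕ∞) ≤ ⊤))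
  have i3 : CompleteSpace E₁ := FiniteDimensional.complete ℝ E₁
  set φ := extChartAt 𝓘(ℝ, E₁) x with hφ
  set z := φ x with hz
  have hzt : z ∈ φ.target := mem_extChartAt_target x
  have hzx : φ.symm z = x := extChartAt_to_inv x
  have htn : φ.target ∈ 𝓝 z := extChartAt_target_mem_nhds x
  have dd : ∀ U : ∀ g : G, TangentSpace 𝓘(ℝ, E₁) g,
      ContMDiff 𝓘(ℝ, E₁) 𝓘(ℝ, E₁).tangent ∞ (fun g => (⟨g, U g⟩ : TangentBundle 𝓘(ℝ, E₁) G)) →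
      DifferentiableAt ℝ (inChart U x) z := by
    intro U hU
    have := ((hU x).mdifferentiableAt (by simp)).mdifferentiableWithinAt (s := univ)
      |>.differentiableWithinAt_mpullbackWithin_vectorField
    have h2 : DifferentiableWithinAt ℝ (inChart U x)
      ((extChartAt 𝓘(ℝ, E₁) x).symm ⁻¹' univ ∩ range 𝓘(ℝ, E₁)) z := this
    have hu : (extChartAt 𝓘(ℝ, E₁) x).symm ⁻¹' univ ∩ range 𝓘(ℝ, E₁) = univ := by simp
    rwa [hu, differentiableWithinAt_univ] at h2
  have cF : ContDiffAt ℝ 2 (F ∘ φ.symm) z := by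
    have h1 : ContMDiffAt 𝓘(ℝ, E₁) 𝓘(ℝ, E₁) 2 φ.symm z :=
      ((contMDiffOn_extChartAt_symm (n := ∞) x).contMDiffAt htn).of_le (WithTop.coe_le_coe.2 (le_top : (2 : ℕ∞) ≤ ⊤))
    exact (((hF _).of_le (WithTop.coe_le_coe.2 (le_top : (2 : ℕ∞) ≤ ⊤))).comp z h1).contDiffAt
  have key : ∀ (U : ∀ g : G, TangentSpace 𝓘(ℝ, E₁) g) (f : G → ℝ),
      ContMDiff 𝓘(ℝ, E₁) 𝓘(ℝ) ∞ f → ∀ y ∈ φ.target,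
      fderiv ℝ (f ∘ φ.symm) y (inChart U x y) = act U f (φ.symm y) := fun U f hf y hy =>
    act_comp_symm hy ((hf _).mdifferentiableAt (by simp)) U
  have second : ∀ (U₁ U₂ : ∀ g : G, TangentSpace 𝓘(ℝ, E₁) g),
      ContMDiff 𝓘(ℝ, E₁) 𝓘(ℝ) ∞ (act U₂ F) →
      act U₁ (act U₂ F) x =
        fderiv ℝ (fun y => fderiv ℝ (F ∘ φ.symm) y (inChart U₂ x y)) z (inChart U₁ x z) := by
    intro U₁ U₂ h2
    have h := key U₁ _ h2 z hzt
    rw [hzx] at h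
    rw [← h]
    have he : (act U₂ F) ∘ φ.symm =ᶠ[𝓝 z]
        fun y => fderiv ℝ (F ∘ φ.symm) y (inChart U₂ x y) := by
      filter_upwards [htn] with y hy
      exact (key U₂ F hF y hy).symm
    rw [he.fderiv_eq]
  rw [second V W hWF, second W V hVF, ← lieBracket_second cF (dd V hV) (dd W hW),
    fderiv_comp_extChartAt_symm hzt ((hF _).mdifferentiableAt (by simp))]
  have := congrArg (fun p : TangentBundle 𝓘(ℝ, E₁) G =>
    (mfderiv 𝓘(ℝ, E₁) 𝓘(ℝ) F p.1 p.2 : ℝ)) (symmDeriv_lieBracket x V W)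
  exact this.symm

end LieGroupoid.Aux

/-- A Lie groupoid `𝒢` over the manifold `M`, with manifold of arrows `G`: a groupoid with objects
`M` and arrows `G` whose structure maps are smooth and whose source and target maps are submersions.
(If `G` is Hausdorff and paracompact, then so are the fibres of the source and target maps.)

The composition `mul g h = g h` is only meaningful if `source g = target h`; it is represented by a
function on all of `G × G`, whose other values play no role. -/
structure LieGroupoid (E₀ M E₁ G : Type*) [NormedAddCommGroup E₀] [NormedSpace ℝ E₀]
    [TopologicalSpace M] [ChartedSpace E₀ M]
    [NormedAddCommGroup E₁] [NormedSpace ℝ E₁] [TopologicalSpace G] [ChartedSpace E₁ G] where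
  /-- The source map `s`. -/
  source : G → M
  /-- The target map `t`. -/
  target : G → M
  /-- The unit arrows `x ↦ 1_x`. -/
  unit : M → G
  /-- The inverse map. -/
  inv : G → G
  /-- The composition `(g, h) ↦ g h`, defined for `s(g) = t(h)`. -/
  mul : G → G → G
  source_unit : ∀ x, source (unit x) = x
  target_unit : ∀ x, target (unit x) = x
  source_mul : ∀ g h, source g = target h → source (mul g h) = source h
  target_mul : ∀ g h, source g = target h → target (mul g h) = target g
  unit_mul : ∀ g, mul (unit (target g)) g = g
  mul_unit : ∀ g, mul g (unit (source g)) = g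
  mul_assoc : ∀ g h k, source g = target h → source h = target k →
    mul (mul g h) k = mul g (mul h k)
  source_inv : ∀ g, source (inv g) = target g
  target_inv : ∀ g, target (inv g) = source g
  inv_mul : ∀ g, mul (inv g) g = unit (source g)
  mul_inv : ∀ g, mul g (inv g) = unit (target g)
  isSubmersion_source : Manifold.IsSubmersion 𝓘(ℝ, E₁) 𝓘(ℝ, E₀) ∞ source
  isSubmersion_target : Manifold.IsSubmersion 𝓘(ℝ, E₁) 𝓘(ℝ, E₀) ∞ target
  contMDiff_unit : ContMDiff 𝓘(ℝ, E₀) 𝓘(ℝ, E₁) ∞ unit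
  contMDiff_inv : ContMDiff 𝓘(ℝ, E₁) 𝓘(ℝ, E₁) ∞ inv
  /-- The composition is smooth on the submanifold of composable pairs: it extends smoothly to a
  neighbourhood in `G × G` of any composable pair. -/
  contMDiffOn_mul : ContMDiffOn (𝓘(ℝ, E₁).prod 𝓘(ℝ, E₁)) 𝓘(ℝ, E₁) ∞
    (fun p : G × G => mul p.1 p.2) {p | source p.1 = target p.2}

namespace LieGroupoid
open Aux Set Filter VectorField

variable {E₀ M E₁ G : Type*} [NormedAddCommGroup E₀] [NormedSpace ℝ E₀]
  [TopologicalSpace M] [ChartedSpace E₀ M]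
  [NormedAddCommGroup E₁] [NormedSpace ℝ E₁] [TopologicalSpace G] [ChartedSpace E₁ G]
  (𝒢 : LieGroupoid E₀ M E₁ G)

theorem contMDiff_source [IsManifold 𝓘(ℝ, E₁) ∞ G] [IsManifold 𝓘(ℝ, E₀) ∞ M] :
    ContMDiff 𝓘(ℝ, E₁) 𝓘(ℝ, E₀) ∞ 𝒢.source := 𝒢.isSubmersion_source.contMDiff

theorem contMDiff_target [IsManifold 𝓘(ℝ, E₁) ∞ G] [IsManifold 𝓘(ℝ, E₀) ∞ M] :
    ContMDiff 𝓘(ℝ, E₁) 𝓘(ℝ, E₀) ∞ 𝒢.target := 𝒢.isSubmersion_target.contMDiff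

theorem contMDiff_add_along [IsManifold 𝓘(ℝ, E₁) ∞ G] {u : M → G}
    {X Y : ∀ x, TangentSpace 𝓘(ℝ, E₁) (u x)}
    (hX : ContMDiff 𝓘(ℝ, E₀) 𝓘(ℝ, E₁).tangent ∞ (fun x => (⟨u x, X x⟩ : TangentBundle 𝓘(ℝ, E₁) G)))
    (hY : ContMDiff 𝓘(ℝ, E₀) 𝓘(ℝ, E₁).tangent ∞ (fun x => (⟨u x, Y x⟩ : TangentBundle 𝓘(ℝ, E₁) G))) :
    ContMDiff 𝓘(ℝ, E₀) 𝓘(ℝ, E₁).tangent ∞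
      (fun x => (⟨u x, X x + Y x⟩ : TangentBundle 𝓘(ℝ, E₁) G)) := by
  have i1 : IsManifold 𝓘(ℝ, E₁) 1 G := .of_le (n := ∞) (by simp)
  intro x₀
  have hx := Bundle.contMDiffAt_totalSpace.1 (hX x₀)
  have hy := Bundle.contMDiffAt_totalSpace.1 (hY x₀)
  refine Bundle.contMDiffAt_totalSpace.2 ⟨hx.1, (hx.2.add hy.2).congr_of_eventuallyEq ?_⟩
  set e := trivializationAt E₁ (TangentSpace 𝓘(ℝ, E₁)) (u x₀)
  have hc : ContinuousAt u x₀ := hx.1.continuousAt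
  filter_upwards [hc.preimage_mem_nhds (e.open_baseSet.mem_nhds
    (FiberBundle.mem_baseSet_trivializationAt' (u x₀)))] with x hx
  exact (e.linear ℝ hx).1 _ _

theorem contMDiff_smul_along [IsManifold 𝓘(ℝ, E₁) ∞ G] {u : M → G} {f : M → ℝ}
    {X : ∀ x, TangentSpace 𝓘(ℝ, E₁) (u x)} (hf : ContMDiff 𝓘(ℝ, E₀) 𝓘(ℝ) ∞ f)
    (hX : ContMDiff 𝓘(ℝ, E₀) 𝓘(ℝ, E₁).tangent ∞ (fun x => (⟨u x, X x⟩ : TangentBundle 𝓘(ℝ, E₁) G))) :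
    ContMDiff 𝓘(ℝ, E₀) 𝓘(ℝ, E₁).tangent ∞
      (fun x => (⟨u x, f x • X x⟩ : TangentBundle 𝓘(ℝ, E₁) G)) := by
  have i1 : IsManifold 𝓘(ℝ, E₁) 1 G := .of_le (n := ∞) (by simp)
  intro x₀
  have hx := Bundle.contMDiffAt_totalSpace.1 (hX x₀)
  refine Bundle.contMDiffAt_totalSpace.2 ⟨hx.1, ((hf x₀).smul hx.2).congr_of_eventuallyEq ?_⟩
  set e := trivializationAt E₁ (TangentSpace 𝓘(ℝ, E₁)) (u x₀)
  have hc : ContinuousAt u x₀ := hx.1.continuousAt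
  filter_upwards [hc.preimage_mem_nhds (e.open_baseSet.mem_nhds
    (FiberBundle.mem_baseSet_trivializationAt' (u x₀)))] with x hx
  exact (e.linear ℝ hx).2 _ _

variable [IsManifold 𝓘(ℝ, E₁) ∞ G]

/-- The space `Γ(𝔤)` of smooth sections of the Lie algebroid `𝔤` of `𝒢`, the pull-back along the unit
map of the kernel of `dt : TG → TM`: smooth families `X x ∈ T_{1_x} G` with `dt (X x) = 0`. -/
def algebroidSections : Submodule ℝ (∀ x : M, TangentSpace 𝓘(ℝ, E₁) (𝒢.unit x)) where
  carrier := {X | (∀ x, mfderiv 𝓘(ℝ, E₁) 𝓘(ℝ, E₀) 𝒢.target (𝒢.unit x) (X x) = 0) ∧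
    ContMDiff 𝓘(ℝ, E₀) 𝓘(ℝ, E₁).tangent ∞
      (fun x => (⟨𝒢.unit x, X x⟩ : TangentBundle 𝓘(ℝ, E₁) G))}
  add_mem' {X Y} hX hY := ⟨fun x => by rw [Pi.add_apply, map_add, hX.1 x, hY.1 x, add_zero],
    contMDiff_add_along hX.2 hY.2⟩
  zero_mem' := ⟨fun x => by rw [Pi.zero_apply, map_zero], by
    have i1 : IsManifold 𝓘(ℝ, E₁) 1 G := .of_le (n := ∞) (by simp)
    exact (Bundle.contMDiff_zeroSection ℝ (TangentSpace 𝓘(ℝ, E₁) : G → Type _)).comp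
      𝒢.contMDiff_unit⟩
  smul_mem' c X hX := ⟨fun x => by rw [Pi.smul_apply, map_smul, hX.1 x, smul_zero],
    contMDiff_smul_along contMDiff_const hX.2⟩

/-- The left-invariant vector field `X̄` on `G` given by a section `X` of `𝔤`, that is
`X̄_g = dL_g (X_{s(g)})`, where `L_g : t⁻¹(s(g)) → t⁻¹(t(g))`, `L_g(h) = g h`, is the left translation.
The derivative is that of `h ↦ g h` along the embedded submanifold `t⁻¹(s(g))` of `G`; it is determined
on the tangent vectors of this fibre, see `deriv_fibre_unique`. -/
noncomputable def leftInvariantField (X : ∀ x : M, TangentSpace 𝓘(ℝ, E₁) (𝒢.unit x)) (g : G) :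
    TangentSpace 𝓘(ℝ, E₁) g :=
  mfderivWithin 𝓘(ℝ, E₁) 𝓘(ℝ, E₁) (𝒢.mul g) (𝒢.target ⁻¹' {𝒢.source g}) (𝒢.unit (𝒢.source g))
    (X (𝒢.source g))

/-- The derivative of a map along a target fibre is uniquely determined on the vectors which are
tangent to the fibre. -/
theorem deriv_fibre_unique [IsManifold 𝓘(ℝ, E₀) ∞ M] {E : Type*} [NormedAddCommGroup E]
    [NormedSpace ℝ E] {N : Type*} [TopologicalSpace N] [ChartedSpace E N] {f : G → N} {p : G}
    {f' f'' : TangentSpace 𝓘(ℝ, E₁) p →L[ℝ] TangentSpace 𝓘(ℝ, E) (f p)}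
    (h' : HasMFDerivWithinAt 𝓘(ℝ, E₁) 𝓘(ℝ, E) f (𝒢.target ⁻¹' {𝒢.target p}) p f')
    (h'' : HasMFDerivWithinAt 𝓘(ℝ, E₁) 𝓘(ℝ, E) f (𝒢.target ⁻¹' {𝒢.target p}) p f'')
    {v : TangentSpace 𝓘(ℝ, E₁) p} (hv : mfderiv 𝓘(ℝ, E₁) 𝓘(ℝ, E₀) 𝒢.target p v = 0) :
    f' v = f'' v := by
  obtain ⟨ρ, W, hWo, hpW, hρ, hρt, hρi⟩ := exists_retraction (𝒢.isSubmersion_target.isSubmersionAt p)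
  have di : HasMFDerivAt 𝓘(ℝ, E₁) 𝓘(ℝ, E₁) (fun h : G => h) p (ContinuousLinearMap.id ℝ E₁) :=
    hasMFDerivAt_id p
  have dc : HasMFDerivAt 𝓘(ℝ, E₁) 𝓘(ℝ, E₀) (fun _ : G => 𝒢.target p) p (0 : E₁ →L[ℝ] E₀) :=
    hasMFDerivAt_const _ _
  obtain ⟨ρ', dρ⟩ : ∃ ρ' : E₀ × E₁ →L[ℝ] E₁, HasMFDerivAt (𝓘(ℝ, E₀).prod 𝓘(ℝ, E₁)) 𝓘(ℝ, E₁)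
      ρ (𝒢.target p, p) ρ' :=
    ⟨_, ((hρ.contMDiffAt (hWo.mem_nhds hpW)).mdifferentiableAt (by simp)).hasMFDerivAt⟩
  obtain ⟨t', dt, ht'⟩ : ∃ t' : E₁ →L[ℝ] E₀, HasMFDerivAt 𝓘(ℝ, E₁) 𝓘(ℝ, E₀) 𝒢.target p t' ∧
      t' v = 0 := ⟨_, ((𝒢.contMDiff_target p).mdifferentiableAt (by simp)).hasMFDerivAt, hv⟩
  have d1 : HasMFDerivAt 𝓘(ℝ, E₁) 𝓘(ℝ, E₁) (fun h => ρ (𝒢.target h, h)) p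
      (ρ' ∘L (t'.prod (ContinuousLinearMap.id ℝ E₁))) :=
    HasMFDerivAt.comp (f := fun h => (𝒢.target h, h)) p dρ (dt.prodMk di)
  have d2 : HasMFDerivAt 𝓘(ℝ, E₁) 𝓘(ℝ, E₁) (fun h => ρ (𝒢.target p, h)) p
      (ρ' ∘L ((0 : E₁ →L[ℝ] E₀).prod (ContinuousLinearMap.id ℝ E₁))) :=
    HasMFDerivAt.comp (f := fun h => (𝒢.target p, h)) p dρ (dc.prodMk di)
  have hc1 : ContinuousAt (fun h => (𝒢.target h, h)) p :=
    (𝒢.contMDiff_target.continuous.continuousAt).prodMk continuousAt_id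
  have hc2 : Continuous (fun h : G => (𝒢.target p, h)) := by fun_prop
  have e1 : (fun h => ρ (𝒢.target h, h)) =ᶠ[𝓝 p] fun h => h := by
    filter_upwards [hc1.preimage_mem_nhds (hWo.mem_nhds hpW)] with h hh
    exact hρi h hh
  have d3 := hasMFDerivAt_unique (d1.congr_of_eventuallyEq e1.symm) di
  have d4 : ρ' (t' v, v) = v := DFunLike.congr_fun d3 v
  rw [ht'] at d4
  have hS : IsOpen ((fun h : G => (𝒢.target p, h)) ⁻¹' W) := hWo.preimage hc2
  have hrp : ρ (𝒢.target p, p) = p := hρi p hpW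
  have comp : ∀ F' : E₁ →L[ℝ] E,
      HasMFDerivWithinAt 𝓘(ℝ, E₁) 𝓘(ℝ, E) f (𝒢.target ⁻¹' {𝒢.target p}) p F' →
      HasMFDerivAt 𝓘(ℝ, E₁) 𝓘(ℝ, E) (f ∘ fun h => ρ (𝒢.target p, h)) p
        (F' ∘L (ρ' ∘L ((0 : E₁ →L[ℝ] E₀).prod (ContinuousLinearMap.id ℝ E₁)))) := by
    intro F' hF'
    have aux : ∀ q, q = p →
        HasMFDerivWithinAt 𝓘(ℝ, E₁) 𝓘(ℝ, E) f (𝒢.target ⁻¹' {𝒢.target p}) q F' := by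
      rintro _ rfl; exact hF'
    have := HasMFDerivWithinAt.comp p (aux _ hrp)
      (d2.hasMFDerivWithinAt (s := (fun h : G => (𝒢.target p, h)) ⁻¹' W))
      (fun h hh => hρt _ hh)
    exact this.hasMFDerivAt (hS.mem_nhds hpW)
  have := DFunLike.congr_fun (hasMFDerivAt_unique (comp f' h') (comp f'' h'')) v
  have h4 : f' (ρ' (0, v)) = f'' (ρ' (0, v)) := this
  rwa [d4] at h4

theorem contMDiffWithinAt_mul (g : G) (h : G) (hgh : 𝒢.source g = 𝒢.target h) :
    ContMDiffWithinAt 𝓘(ℝ, E₁) 𝓘(ℝ, E₁) ∞ (𝒢.mul g) (𝒢.target ⁻¹' {𝒢.source g}) h :=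
  (𝒢.contMDiffOn_mul (g, h) hgh).comp (g := fun p : G × G => 𝒢.mul p.1 p.2) h
    (f := fun k => (g, k)) (contMDiffWithinAt_const.prodMk contMDiffWithinAt_id)
    (fun _ hk => hk.symm)

/-- Locally, the multiplication extends smoothly to an open set. -/
theorem exists_mul_extend [IsManifold 𝓘(ℝ, E₀) ∞ M] (g₀ h₀ : G) (h0 : 𝒢.source g₀ = 𝒢.target h₀) :
    ∃ (μ : G × G → G) (W : Set (G × G)), IsOpen W ∧ (g₀, h₀) ∈ W ∧
      ContMDiffOn (𝓘(ℝ, E₁).prod 𝓘(ℝ, E₁)) 𝓘(ℝ, E₁) ∞ μ W ∧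
      ∀ w ∈ W, 𝒢.source w.1 = 𝒢.target w.2 → μ w = 𝒢.mul w.1 w.2 := by
  obtain ⟨ρ, W, hWo, hpW, hρ, hρt, hρi⟩ :=
    exists_retraction (𝒢.isSubmersion_target.isSubmersionAt h₀)
  have hs : ContMDiff (𝓘(ℝ, E₁).prod 𝓘(ℝ, E₁)) (𝓘(ℝ, E₀).prod 𝓘(ℝ, E₁)) ∞
      (fun w : G × G => (𝒢.source w.1, w.2)) :=
    (𝒢.contMDiff_source.comp contMDiff_fst).prodMk contMDiff_snd
  refine ⟨fun w => 𝒢.mul w.1 (ρ (𝒢.source w.1, w.2)), (fun w => (𝒢.source w.1, w.2)) ⁻¹' W,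
    hWo.preimage hs.continuous, by simpa [h0] using hpW, ?_, ?_⟩
  · refine 𝒢.contMDiffOn_mul.comp (f := fun w : G × G => (w.1, ρ (𝒢.source w.1, w.2)))
      (contMDiffOn_fst.prodMk (hρ.comp hs.contMDiffOn fun w hw => hw)) fun w hw => ?_
    exact (hρt _ hw).symm
  · intro w hw hst
    simp only
    rw [hst]
    congr 1
    apply hρi
    rw [← hst]; exact hw

theorem leftInvariantField_eq [IsManifold 𝓘(ℝ, E₀) ∞ M] {μ : G × G → G} {W : Set (G × G)} (hW : IsOpen W)
    (hμ : ContMDiffOn (𝓘(ℝ, E₁).prod 𝓘(ℝ, E₁)) 𝓘(ℝ, E₁) ∞ μ W)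
    (hμm : ∀ w ∈ W, 𝒢.source w.1 = 𝒢.target w.2 → μ w = 𝒢.mul w.1 w.2)
    {X : ∀ x : M, TangentSpace 𝓘(ℝ, E₁) (𝒢.unit x)} (hX : X ∈ 𝒢.algebroidSections) {g : G}
    (hg : (g, 𝒢.unit (𝒢.source g)) ∈ W) :
    (⟨g, 𝒢.leftInvariantField X g⟩ : TangentBundle 𝓘(ℝ, E₁) G) =
    ⟨μ (g, 𝒢.unit (𝒢.source g)), mfderiv 𝓘(ℝ, E₁) 𝓘(ℝ, E₁) (fun h => μ (g, h))
      (𝒢.unit (𝒢.source g)) (X (𝒢.source g))⟩ := by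
  have h0 : 𝒢.source g = 𝒢.target (𝒢.unit (𝒢.source g)) := (𝒢.target_unit _).symm
  have hm : μ (g, 𝒢.unit (𝒢.source g)) = g := by rw [hμm _ hg h0]; exact 𝒢.mul_unit g
  have hcont : Continuous (fun h : G => (g, h)) := by fun_prop
  have hWg : (fun h : G => (g, h)) ⁻¹' W ∈ 𝓝 (𝒢.unit (𝒢.source g)) :=
    (hW.preimage hcont).mem_nhds hg
  have d1 : MDifferentiableAt 𝓘(ℝ, E₁) 𝓘(ℝ, E₁) (fun h => μ (g, h)) (𝒢.unit (𝒢.source g)) := by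
    have : ContMDiffAt 𝓘(ℝ, E₁) 𝓘(ℝ, E₁) ∞ (fun h => μ (g, h)) (𝒢.unit (𝒢.source g)) :=
      ContMDiffAt.comp (f := fun h => (g, h)) _ (hμ.contMDiffAt (hW.mem_nhds hg))
        (contMDiffAt_const.prodMk contMDiffAt_id)
    exact this.mdifferentiableAt (by simp)
  have d2 := ((𝒢.contMDiffWithinAt_mul g _ h0).mdifferentiableWithinAt (by simp)).hasMFDerivWithinAt
  have e : (fun h => μ (g, h)) =ᶠ[𝓝[𝒢.target ⁻¹' {𝒢.source g}] (𝒢.unit (𝒢.source g))] 𝒢.mul g := by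
    filter_upwards [self_mem_nhdsWithin, mem_nhdsWithin_of_mem_nhds hWg] with h h1 h2
    exact hμm _ h2 h1.symm
  have d3 := d2.congr_of_eventuallyEq e (by rw [hμm _ hg h0])
  have hS : 𝒢.target ⁻¹' {𝒢.source g} =
    𝒢.target ⁻¹' {𝒢.target (𝒢.unit (𝒢.source g))} := by rw [← h0]
  rw [hS] at d3
  have := 𝒢.deriv_fibre_unique d3 d1.hasMFDerivAt.hasMFDerivWithinAt (hX.1 (𝒢.source g))
  have aux : ∀ q, q = g → (⟨g, 𝒢.leftInvariantField X g⟩ : TangentBundle 𝓘(ℝ, E₁) G) =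
    ⟨q, 𝒢.leftInvariantField X g⟩ := by rintro _ rfl; rfl
  rw [aux _ hm]
  refine congrArg (fun v => (⟨μ (g, 𝒢.unit (𝒢.source g)), v⟩ : TangentBundle 𝓘(ℝ, E₁) G)) ?_
  rw [← this, leftInvariantField, hS]
  rfl

theorem contMDiffAt_mfderiv_apply {μ : G × G → G} {p : G → G} {v : ∀ g, TangentSpace 𝓘(ℝ, E₁) (p g)}
    {g₀ : G} (hμ : ContMDiffAt (𝓘(ℝ, E₁).prod 𝓘(ℝ, E₁)) 𝓘(ℝ, E₁) ∞ μ (g₀, p g₀))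
    (hv : ContMDiffAt 𝓘(ℝ, E₁) 𝓘(ℝ, E₁).tangent ∞
      (fun g => (⟨p g, v g⟩ : TangentBundle 𝓘(ℝ, E₁) G)) g₀) :
    ContMDiffAt 𝓘(ℝ, E₁) 𝓘(ℝ, E₁).tangent ∞ (fun g =>
      (⟨μ (g, p g), mfderiv 𝓘(ℝ, E₁) 𝓘(ℝ, E₁) (fun h => μ (g, h)) (p g) (v g)⟩ :
        TangentBundle 𝓘(ℝ, E₁) G)) g₀ := by
  have i1 : IsManifold 𝓘(ℝ, E₁) 1 G := .of_le (n := ∞) (by simp)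
  have hp : ContMDiffAt 𝓘(ℝ, E₁) 𝓘(ℝ, E₁) ∞ p g₀ := (Bundle.contMDiffAt_totalSpace.1 hv).1
  have hin := ContMDiffAt.mfderiv (m := ∞) (n := ∞) (fun g h => μ (g, h)) p hμ hp (by simp)
  have hb : ContMDiffAt 𝓘(ℝ, E₁) 𝓘(ℝ, E₁) ∞ (fun g => μ (g, p g)) g₀ :=
    ContMDiffAt.comp (f := fun g => (g, p g)) _ hμ (contMDiffAt_id.prodMk hp)
  exact ContMDiffAt.clm_apply_of_inCoordinates (F₁ := E₁) (F₂ := E₁) (E₁ := fun x : G => TangentSpace 𝓘(ℝ, E₁) x) (E₂ := fun x : G => TangentSpace 𝓘(ℝ, E₁) x) (b₁ := p) (b₂ := fun g => μ (g, p g)) 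
    (v := v) (ϕ := fun g => mfderiv 𝓘(ℝ, E₁) 𝓘(ℝ, E₁) (fun h => μ (g, h)) (p g)) hin hv hb

theorem contMDiff_leftInvariantField [IsManifold 𝓘(ℝ, E₀) ∞ M]
    {X : ∀ x : M, TangentSpace 𝓘(ℝ, E₁) (𝒢.unit x)} (hX : X ∈ 𝒢.algebroidSections) :
    ContMDiff 𝓘(ℝ, E₁) 𝓘(ℝ, E₁).tangent ∞
      (fun g => (⟨g, 𝒢.leftInvariantField X g⟩ : TangentBundle 𝓘(ℝ, E₁) G)) := by
  have i1 : IsManifold 𝓘(ℝ, E₁) 1 G := .of_le (n := ∞) (by simp)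
  intro g₀
  obtain ⟨μ, W, hW, h0, hμ, hμm⟩ := 𝒢.exists_mul_extend g₀ (𝒢.unit (𝒢.source g₀))
    (𝒢.target_unit _).symm
  have hus : ContMDiff 𝓘(ℝ, E₁) 𝓘(ℝ, E₁) ∞ (fun g => 𝒢.unit (𝒢.source g)) :=
    𝒢.contMDiff_unit.comp 𝒢.contMDiff_source
  have hv : ContMDiffAt 𝓘(ℝ, E₁) 𝓘(ℝ, E₁).tangent ∞ (fun g =>
      (⟨𝒢.unit (𝒢.source g), X (𝒢.source g)⟩ : TangentBundle 𝓘(ℝ, E₁) G)) g₀ :=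
    (hX.2.comp 𝒢.contMDiff_source) g₀
  have := contMDiffAt_mfderiv_apply (p := fun g => 𝒢.unit (𝒢.source g))
    (v := fun g => X (𝒢.source g)) (hμ.contMDiffAt (hW.mem_nhds h0)) hv
  refine this.congr_of_eventuallyEq ?_
  have hc : Continuous (fun g => (g, 𝒢.unit (𝒢.source g))) := continuous_id.prodMk hus.continuous
  filter_upwards [(hW.preimage hc).mem_nhds h0] with g hg
  exact 𝒢.leftInvariantField_eq hW hμ hμm hX hg

end LieGroupoid

namespace LieGroupoid
open Aux Set Filter VectorField

variable {E₀ M E₁ G : Type*} [NormedAddCommGroup E₀] [NormedSpace ℝ E₀]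
  [TopologicalSpace M] [ChartedSpace E₀ M]
  [NormedAddCommGroup E₁] [NormedSpace ℝ E₁] [TopologicalSpace G] [ChartedSpace E₁ G]
  (𝒢 : LieGroupoid E₀ M E₁ G)
variable [IsManifold 𝓘(ℝ, E₁) ∞ G] [IsManifold 𝓘(ℝ, E₀) ∞ M]

theorem act_leftInvariantField {X : ∀ x : M, TangentSpace 𝓘(ℝ, E₁) (𝒢.unit x)}
    (hX : X ∈ 𝒢.algebroidSections) {F K : G → ℝ} {g : G}
    (hF : MDifferentiableAt 𝓘(ℝ, E₁) 𝓘(ℝ) F g)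
    (hK : MDifferentiableAt 𝓘(ℝ, E₁) 𝓘(ℝ) K (𝒢.unit (𝒢.source g)))
    (h : ∀ᶠ h in 𝓝[𝒢.target ⁻¹' {𝒢.source g}] 𝒢.unit (𝒢.source g), K h = F (𝒢.mul g h)) :
    act (𝒢.leftInvariantField X) F g =
      mfderiv 𝓘(ℝ, E₁) 𝓘(ℝ) K (𝒢.unit (𝒢.source g)) (X (𝒢.source g)) := by
  have h0 : 𝒢.source g = 𝒢.target (𝒢.unit (𝒢.source g)) := (𝒢.target_unit _).symm
  have d2 := ((𝒢.contMDiffWithinAt_mul g _ h0).mdifferentiableWithinAt (by simp)).hasMFDerivWithinAt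
  obtain ⟨F', hF'⟩ : ∃ F' : E₁ →L[ℝ] ℝ, HasMFDerivAt 𝓘(ℝ, E₁) 𝓘(ℝ) F g F' := ⟨_, hF.hasMFDerivAt⟩
  have aux : ∀ q, q = g → HasMFDerivAt 𝓘(ℝ, E₁) 𝓘(ℝ) F q F' := by rintro _ rfl; exact hF'
  have d3 := HasMFDerivAt.comp_hasMFDerivWithinAt _ (aux _ (𝒢.mul_unit g)) d2
  have h1 := h.self_of_nhdsWithin (show _ ∈ 𝒢.target ⁻¹' {𝒢.source g} from h0.symm)
  have d4 := d3.congr_of_eventuallyEq (f₁ := K) h h1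
  have hS : 𝒢.target ⁻¹' {𝒢.source g} =
    𝒢.target ⁻¹' {𝒢.target (𝒢.unit (𝒢.source g))} := by rw [← h0]
  rw [hS] at d4
  have := 𝒢.deriv_fibre_unique d4 hK.hasMFDerivAt.hasMFDerivWithinAt (hX.1 (𝒢.source g))
  have e : act (𝒢.leftInvariantField X) F g = F' (𝒢.leftInvariantField X g) :=
    DFunLike.congr_fun hF'.mfderiv _
  rw [e, ← this, ← hS]
  rfl

theorem contMDiff_act {V : ∀ g : G, TangentSpace 𝓘(ℝ, E₁) g}
    (hV : ContMDiff 𝓘(ℝ, E₁) 𝓘(ℝ, E₁).tangent ∞ (fun g => (⟨g, V g⟩ : TangentBundle 𝓘(ℝ, E₁) G)))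
    {F : G → ℝ} (hF : ContMDiff 𝓘(ℝ, E₁) 𝓘(ℝ) ∞ F) :
    ContMDiff 𝓘(ℝ, E₁) 𝓘(ℝ) ∞ (act V F) := by
  have h1 : ContMDiff 𝓘(ℝ, E₁).tangent 𝓘(ℝ, ℝ).tangent ∞ (tangentMap 𝓘(ℝ, E₁) 𝓘(ℝ, ℝ) F) :=
    hF.contMDiff_tangentMap (by simp)
  have h2 := contMDiff_snd_tangentBundle_modelSpace (n := ∞) ℝ 𝓘(ℝ, ℝ)
  exact h2.comp (h1.comp hV)

/-- Left-invariant vector fields commute with left translations. -/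
theorem act_equivariant {X : ∀ x : M, TangentSpace 𝓘(ℝ, E₁) (𝒢.unit x)}
    (hX : X ∈ 𝒢.algebroidSections) {F F' : G → ℝ} {g : G}
    (hF : ContMDiff 𝓘(ℝ, E₁) 𝓘(ℝ) ∞ F) (hF' : ContMDiff 𝓘(ℝ, E₁) 𝓘(ℝ) ∞ F')
    (h : ∀ᶠ h in 𝓝[𝒢.target ⁻¹' {𝒢.source g}] 𝒢.unit (𝒢.source g), F' h = F (𝒢.mul g h)) :
    ∀ᶠ h in 𝓝[𝒢.target ⁻¹' {𝒢.source g}] 𝒢.unit (𝒢.source g),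
      act (𝒢.leftInvariantField X) F' h = act (𝒢.leftInvariantField X) F (𝒢.mul g h) := by
  filter_upwards [eventually_eventually_nhdsWithin.2 h, self_mem_nhdsWithin] with h hh hht
  have hht : 𝒢.target h = 𝒢.source g := hht
  obtain ⟨μ, W, hW, h0, hμ, hμm⟩ := 𝒢.exists_mul_extend h (𝒢.unit (𝒢.source h))
    (𝒢.target_unit _).symm
  have hcont : Continuous (fun k : G => (h, k)) := by fun_prop
  have hc : ContMDiffAt 𝓘(ℝ, E₁) 𝓘(ℝ, E₁) ∞ (fun k => μ (h, k)) (𝒢.unit (𝒢.source h)) :=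
    ContMDiffAt.comp (f := fun k => (h, k)) _ (hμ.contMDiffAt (hW.mem_nhds h0))
      (contMDiffAt_const.prodMk contMDiffAt_id)
  have hK : MDifferentiableAt 𝓘(ℝ, E₁) 𝓘(ℝ) (fun k => F' (μ (h, k))) (𝒢.unit (𝒢.source h)) :=
    ((hF' _).comp (𝒢.unit (𝒢.source h)) hc).mdifferentiableAt (by simp)
  have hWh : ∀ᶠ k in 𝓝[𝒢.target ⁻¹' {𝒢.source h}] 𝒢.unit (𝒢.source h), (h, k) ∈ W :=
    mem_nhdsWithin_of_mem_nhds ((hW.preimage hcont).mem_nhds h0)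
  have hs : 𝒢.source (𝒢.mul g h) = 𝒢.source h := 𝒢.source_mul g h hht.symm
  rw [𝒢.act_leftInvariantField hX ((hF' _).mdifferentiableAt (by simp)) hK]
  · have aux : ∀ x, x = 𝒢.source h → (∀ᶠ k in 𝓝[𝒢.target ⁻¹' {x}] 𝒢.unit x,
        F' (μ (h, k)) = F (𝒢.mul (𝒢.mul g h) k)) → x = 𝒢.source (𝒢.mul g h) →
        (mfderiv 𝓘(ℝ, E₁) 𝓘(ℝ) (fun k => F' (μ (h, k))) (𝒢.unit (𝒢.source h)) (X (𝒢.source h)) : ℝ)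
          = act (𝒢.leftInvariantField X) F (𝒢.mul g h) := by
      intro x hx
      subst hx
      intro h3 h4
      have : ∀ q, q = 𝒢.source h →
        (mfderiv 𝓘(ℝ, E₁) 𝓘(ℝ) (fun k => F' (μ (h, k))) (𝒢.unit (𝒢.source h)) (X (𝒢.source h)) : ℝ)
        = mfderiv 𝓘(ℝ, E₁) 𝓘(ℝ) (fun k => F' (μ (h, k))) (𝒢.unit q) (X q) := by
        rintro _ rfl; rfl
      rw [this _ hs]
      refine (𝒢.act_leftInvariantField hX ((hF _).mdifferentiableAt (by simp)) ?_ ?_).symm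
      · rw [hs]; exact hK
      · rw [hs]; exact h3
    refine aux _ rfl ?_ hs.symm
    have ht : Tendsto (𝒢.mul h) (𝓝[𝒢.target ⁻¹' {𝒢.source h}] 𝒢.unit (𝒢.source h))
        (𝓝[𝒢.target ⁻¹' {𝒢.source g}] h) := by
      have c := (𝒢.contMDiffWithinAt_mul h _ (𝒢.target_unit _).symm).continuousWithinAt
      refine tendsto_nhdsWithin_iff.2 ⟨?_, ?_⟩
      · have := c.tendsto
        rwa [𝒢.mul_unit] at this
      · filter_upwards [self_mem_nhdsWithin] with k hk
        exact (𝒢.target_mul h k (Eq.symm hk)).trans hht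
    filter_upwards [hWh, self_mem_nhdsWithin, ht.eventually hh] with k hk hkt hkF
    rw [hμm _ hk (Eq.symm hkt), hkF, 𝒢.mul_assoc g h k hht.symm (Eq.symm hkt)]
  · filter_upwards [hWh, self_mem_nhdsWithin] with k hk hkt
    rw [hμm _ hk (Eq.symm hkt)]

/-- Near `1_{s(g)}`, the function `h ↦ F (g h)` on the target fibre extends to a smooth function on
`G`. -/
theorem exists_translate [FiniteDimensional ℝ E₁] [T2Space G] (g : G) {F : G → ℝ}
    (hF : ContMDiff 𝓘(ℝ, E₁) 𝓘(ℝ) ∞ F) :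
    ∃ F' : C^∞⟮𝓘(ℝ, E₁), G; ℝ⟯,
      ∀ᶠ h in 𝓝[𝒢.target ⁻¹' {𝒢.source g}] 𝒢.unit (𝒢.source g), F' h = F (𝒢.mul g h) := by
  obtain ⟨μ, W, hW, h0, hμ, hμm⟩ := 𝒢.exists_mul_extend g (𝒢.unit (𝒢.source g))
    (𝒢.target_unit _).symm
  have hcont : Continuous (fun k : G => (g, k)) := by fun_prop
  have hWh : ∀ᶠ k in 𝓝 (𝒢.unit (𝒢.source g)), (g, k) ∈ W := ((hW.preimage hcont).mem_nhds h0)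
  have hc : ∀ᶠ k in 𝓝 (𝒢.unit (𝒢.source g)), ContMDiffAt 𝓘(ℝ, E₁) 𝓘(ℝ) ∞ (fun k => F (μ (g, k))) k := by
    filter_upwards [hWh] with k hk
    exact (hF _).comp k (ContMDiffAt.comp (f := fun k => (g, k)) _ (hμ.contMDiffAt (hW.mem_nhds hk))
      (contMDiffAt_const.prodMk contMDiffAt_id))
  obtain ⟨F', e⟩ := exists_extend hc
  refine ⟨F', ?_⟩
  filter_upwards [self_mem_nhdsWithin, mem_nhdsWithin_of_mem_nhds hWh,
    mem_nhdsWithin_of_mem_nhds e] with k hk h1 h2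
  have h2 : F' k = F (μ (g, k)) := h2
  rw [h2, hμm _ h1 (Eq.symm hk)]

theorem leftInvariantField_unit {X : ∀ x : M, TangentSpace 𝓘(ℝ, E₁) (𝒢.unit x)}
    (hX : X ∈ 𝒢.algebroidSections) {F : G → ℝ} (hF : ContMDiff 𝓘(ℝ, E₁) 𝓘(ℝ) ∞ F) (x : M) :
    act (𝒢.leftInvariantField X) F (𝒢.unit x) = mfderiv 𝓘(ℝ, E₁) 𝓘(ℝ) F (𝒢.unit x) (X x) := by
  have := 𝒢.act_leftInvariantField hX (g := 𝒢.unit x) (F := F) (K := F)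
    ((hF _).mdifferentiableAt (by simp)) ((hF _).mdifferentiableAt (by simp)) (by
      filter_upwards [self_mem_nhdsWithin] with k hk
      have hk : 𝒢.target k = x := Eq.trans hk (𝒢.source_unit x)
      have := 𝒢.unit_mul k
      rw [hk] at this
      rw [this])
  rw [this]
  have : ∀ q, q = x → (mfderiv 𝓘(ℝ, E₁) 𝓘(ℝ) F (𝒢.unit q) (X q) : ℝ) =
    mfderiv 𝓘(ℝ, E₁) 𝓘(ℝ) F (𝒢.unit x) (X x) := by rintro _ rfl; rfl
  exact this _ (𝒢.source_unit x)

end LieGroupoid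

namespace LieGroupoid
open Aux Set Filter VectorField

variable {E₀ M E₁ G : Type*} [NormedAddCommGroup E₀] [NormedSpace ℝ E₀]
  [TopologicalSpace M] [ChartedSpace E₀ M]
  [NormedAddCommGroup E₁] [NormedSpace ℝ E₁] [TopologicalSpace G] [ChartedSpace E₁ G]
  (𝒢 : LieGroupoid E₀ M E₁ G)
variable [IsManifold 𝓘(ℝ, E₁) ∞ G] [IsManifold 𝓘(ℝ, E₀) ∞ M]
  [FiniteDimensional ℝ E₁] [T2Space G]

/-- The Lie bracket of sections of `𝔤`: the restriction to the units of the usual Lie bracket of the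
corresponding left-invariant vector fields. -/
noncomputable def bracketSection (X Y : ∀ x : M, TangentSpace 𝓘(ℝ, E₁) (𝒢.unit x)) (x : M) :
    TangentSpace 𝓘(ℝ, E₁) (𝒢.unit x) :=
  mlieBracket 𝓘(ℝ, E₁) (𝒢.leftInvariantField X) (𝒢.leftInvariantField Y) (𝒢.unit x)

theorem act_comp_target {X : ∀ x : M, TangentSpace 𝓘(ℝ, E₁) (𝒢.unit x)}
    (hX : X ∈ 𝒢.algebroidSections) {f : M → ℝ} (hf : ContMDiff 𝓘(ℝ, E₀) 𝓘(ℝ) ∞ f) :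
    act (𝒢.leftInvariantField X) (f ∘ 𝒢.target) = fun _ => 0 := by
  funext g
  rw [𝒢.act_leftInvariantField hX (K := fun _ => f (𝒢.target g))
    ((hf.comp 𝒢.contMDiff_target g).mdifferentiableAt (by simp)) mdifferentiableAt_const]
  · rw [mfderiv_const]; rfl
  · filter_upwards [self_mem_nhdsWithin] with k hk
    simp [𝒢.target_mul g k (Eq.symm hk)]

theorem act_comp_source {X : ∀ x : M, TangentSpace 𝓘(ℝ, E₁) (𝒢.unit x)}
    (hX : X ∈ 𝒢.algebroidSections) {f : M → ℝ} (hf : ContMDiff 𝓘(ℝ, E₀) 𝓘(ℝ) ∞ f) (g : G) :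
    act (𝒢.leftInvariantField X) (f ∘ 𝒢.source) g =
      act (𝒢.leftInvariantField X) (f ∘ 𝒢.source) (𝒢.unit (𝒢.source g)) := by
  have hfs := hf.comp 𝒢.contMDiff_source
  rw [𝒢.leftInvariantField_unit hX hfs, 𝒢.act_leftInvariantField hX (K := f ∘ 𝒢.source)
    ((hfs g).mdifferentiableAt (by simp)) ((hfs _).mdifferentiableAt (by simp))]
  filter_upwards [self_mem_nhdsWithin] with k hk
  simp [𝒢.source_mul g k (Eq.symm hk)]

theorem bracketSection_mem [FiniteDimensional ℝ E₀] [T2Space M]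
    {X Y : ∀ x : M, TangentSpace 𝓘(ℝ, E₁) (𝒢.unit x)}
    (hX : X ∈ 𝒢.algebroidSections) (hY : Y ∈ 𝒢.algebroidSections) :
    𝒢.bracketSection X Y ∈ 𝒢.algebroidSections := by
  have i1 : IsManifold 𝓘(ℝ, E₁) 1 G := .of_le (n := ∞) (by simp)
  have i3 : CompleteSpace E₁ := FiniteDimensional.complete ℝ E₁
  have cX := 𝒢.contMDiff_leftInvariantField hX
  have cY := 𝒢.contMDiff_leftInvariantField hY
  constructor
  · intro x
    refine tangent_ext fun f => ?_
    have hf : ContMDiff 𝓘(ℝ, E₁) 𝓘(ℝ) ∞ (f ∘ 𝒢.target) := f.contMDiff.comp 𝒢.contMDiff_target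
    have h1 := act_mlieBracket cX cY hf (contMDiff_act cX hf) (contMDiff_act cY hf) (𝒢.unit x)
    rw [𝒢.act_comp_target hX f.contMDiff, 𝒢.act_comp_target hY f.contMDiff] at h1
    have h2 : act (𝒢.leftInvariantField X) (fun _ => (0 : ℝ)) (𝒢.unit x) = 0 := by
      rw [act, mfderiv_const]; rfl
    have h3 : act (𝒢.leftInvariantField Y) (fun _ => (0 : ℝ)) (𝒢.unit x) = 0 := by
      rw [act, mfderiv_const]; rfl
    rw [h2, h3, sub_zero] at h1
    have d1 : HasMFDerivAt 𝓘(ℝ, E₀) 𝓘(ℝ) f (𝒢.target (𝒢.unit x)) _ :=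
      ((f.contMDiff _).mdifferentiableAt (by simp)).hasMFDerivAt
    have d2 := ((𝒢.contMDiff_target (𝒢.unit x)).mdifferentiableAt (by simp)).hasMFDerivAt
    have d3 := (d1.comp _ d2).mfderiv
    have h4 := DFunLike.congr_fun d3 (𝒢.bracketSection X Y x)
    have h5 := h4.symm.trans h1
    exact h5.trans (map_zero (mfderiv 𝓘(ℝ, E₀) 𝓘(ℝ) f (𝒢.target (𝒢.unit x)))).symm
  · have : IsManifold 𝓘(ℝ, E₁) ((⊤ : ℕ∞) + 1) G := inferInstanceAs (IsManifold 𝓘(ℝ, E₁) ∞ G)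
    have i4 : IsManifold 𝓘(ℝ, E₁) (minSmoothness ℝ 2) G := by
      rw [minSmoothness_of_isRCLikeNormedField]
      exact .of_le (n := ∞) (WithTop.coe_le_coe.2 (le_top : (2 : ℕ∞) ≤ ⊤))
    have h : ContMDiff 𝓘(ℝ, E₁) 𝓘(ℝ, E₁).tangent ∞ (fun g =>
      (⟨g, mlieBracket 𝓘(ℝ, E₁) (𝒢.leftInvariantField X) (𝒢.leftInvariantField Y) g⟩ :
        TangentBundle 𝓘(ℝ, E₁) G)) := fun g =>
      ContMDiffAt.mlieBracket_vectorField (m := ⊤) (n := ⊤) (cX g) (cY g) (by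
        rw [minSmoothness_of_isRCLikeNormedField]; exact le_rfl)
    exact h.comp 𝒢.contMDiff_unit

theorem act_lie [FiniteDimensional ℝ E₀] [T2Space M]
    {X Y : ∀ x : M, TangentSpace 𝓘(ℝ, E₁) (𝒢.unit x)}
    (hX : X ∈ 𝒢.algebroidSections) (hY : Y ∈ 𝒢.algebroidSections) {F : G → ℝ}
    (hF : ContMDiff 𝓘(ℝ, E₁) 𝓘(ℝ) ∞ F) (g : G) :
    act (𝒢.leftInvariantField (𝒢.bracketSection X Y)) F g =
      act (𝒢.leftInvariantField X) (act (𝒢.leftInvariantField Y) F) g -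
      act (𝒢.leftInvariantField Y) (act (𝒢.leftInvariantField X) F) g := by
  have cX := 𝒢.contMDiff_leftInvariantField hX
  have cY := 𝒢.contMDiff_leftInvariantField hY
  obtain ⟨F', e⟩ := 𝒢.exists_translate g hF
  have hF' : ContMDiff 𝓘(ℝ, E₁) 𝓘(ℝ) ∞ F' := F'.contMDiff
  rw [𝒢.act_leftInvariantField (𝒢.bracketSection_mem hX hY) ((hF g).mdifferentiableAt (by simp))
    ((hF' _).mdifferentiableAt (by simp)) e]
  have h1 := act_mlieBracket cX cY hF' (contMDiff_act cX hF') (contMDiff_act cY hF')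
    (𝒢.unit (𝒢.source g))
  have key : ∀ {U V : ∀ x : M, TangentSpace 𝓘(ℝ, E₁) (𝒢.unit x)},
      U ∈ 𝒢.algebroidSections → V ∈ 𝒢.algebroidSections →
      act (𝒢.leftInvariantField U) (act (𝒢.leftInvariantField V) F') (𝒢.unit (𝒢.source g)) =
      act (𝒢.leftInvariantField U) (act (𝒢.leftInvariantField V) F) g := by
    intro U V hU hV
    have cU := 𝒢.contMDiff_leftInvariantField hU
    have cV := 𝒢.contMDiff_leftInvariantField hV
    have e1 := 𝒢.act_equivariant hV hF hF' e
    have e2 := 𝒢.act_equivariant hU (contMDiff_act cV hF) (contMDiff_act cV hF') e1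
    have e3 := e2.self_of_nhdsWithin (show _ ∈ 𝒢.target ⁻¹' {𝒢.source g} from 𝒢.target_unit _)
    rwa [𝒢.mul_unit] at e3
  rw [key hX hY, key hY hX] at h1
  exact h1

end LieGroupoid

namespace LieGroupoid
open Aux Set Filter VectorField

variable {E₀ M E₁ G : Type*} [NormedAddCommGroup E₀] [NormedSpace ℝ E₀]
  [TopologicalSpace M] [ChartedSpace E₀ M]
  [NormedAddCommGroup E₁] [NormedSpace ℝ E₁] [TopologicalSpace G] [ChartedSpace E₁ G]
  {𝒢 : LieGroupoid E₀ M E₁ G}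
variable [IsManifold 𝓘(ℝ, E₁) ∞ G]

/-- The multiplication of a section of `𝔤` by a smooth function on `M`. -/
noncomputable instance : SMul C^∞⟮𝓘(ℝ, E₀), M; ℝ⟯ 𝒢.algebroidSections where
  smul f X := ⟨fun x => f x • X.1 x, fun x => by rw [map_smul, X.2.1 x, smul_zero],
    contMDiff_smul_along f.contMDiff X.2.2⟩

/-- The sections of `𝔤` form a `C^∞(M)`-module. -/
noncomputable instance : Module C^∞⟮𝓘(ℝ, E₀), M; ℝ⟯ 𝒢.algebroidSections where
  one_smul X := Subtype.ext (funext fun x => one_smul ℝ (X.1 x))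
  mul_smul f h X := Subtype.ext (funext fun x => mul_smul (f x) (h x) (X.1 x))
  smul_zero f := Subtype.ext (funext fun x => smul_zero (f x))
  smul_add f X Y := Subtype.ext (funext fun x => smul_add (f x) (X.1 x) (Y.1 x))
  add_smul f h X := Subtype.ext (funext fun x => add_smul (f x) (h x) (X.1 x))
  zero_smul X := Subtype.ext (funext fun x => zero_smul ℝ (X.1 x))

instance : IsScalarTower ℝ C^∞⟮𝓘(ℝ, E₀), M; ℝ⟯ 𝒢.algebroidSections where
  smul_assoc c f X := Subtype.ext (funext fun x => smul_assoc c (f x) (X.1 x))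

variable [IsManifold 𝓘(ℝ, E₀) ∞ M]

variable (𝒢) in
/-- The algebra homomorphism `f ↦ f ∘ s` from `C^∞(M)` to `C^∞(G)`. -/
noncomputable def sourcePullback :
    C^∞⟮𝓘(ℝ, E₀), M; ℝ⟯ →ₐ[ℝ] C^∞⟮𝓘(ℝ, E₁), G; ℝ⟯ where
  toFun f := ⟨f ∘ 𝒢.source, f.contMDiff.comp 𝒢.contMDiff_source⟩
  map_one' := rfl
  map_mul' _ _ := rfl
  map_zero' := rfl
  map_add' _ _ := rfl
  commutes' _ := rfl

theorem sourcePullback_apply (f : C^∞⟮𝓘(ℝ, E₀), M; ℝ⟯) (g : G) :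
    𝒢.sourcePullback f g = f (𝒢.source g) := rfl

theorem sourcePullback_injective : Function.Injective 𝒢.sourcePullback := fun f h e =>
  ContMDiffMap.ext fun x => by
    have := DFunLike.congr_fun e (𝒢.unit x)
    rwa [sourcePullback_apply, sourcePullback_apply, 𝒢.source_unit] at this

/-- The left-invariant vector field `X̄` as an operator `F ↦ X̄(F)` on `C^∞(G)`. -/
noncomputable def leftInvariantOp (X : 𝒢.algebroidSections) :
    C^∞⟮𝓘(ℝ, E₁), G; ℝ⟯ →ₗ[ℝ] C^∞⟮𝓘(ℝ, E₁), G; ℝ⟯ where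
  toFun F := ⟨act (𝒢.leftInvariantField X) F,
    contMDiff_act (𝒢.contMDiff_leftInvariantField X.2) F.contMDiff⟩
  map_add' F K := ContMDiffMap.ext fun g => by
    have h1 := ((F.contMDiff g).mdifferentiableAt (by simp)).hasMFDerivAt
    have h2 := ((K.contMDiff g).mdifferentiableAt (by simp)).hasMFDerivAt
    exact DFunLike.congr_fun (h1.add h2).mfderiv (𝒢.leftInvariantField X g)
  map_smul' c F := ContMDiffMap.ext fun g => by
    have h1 := ((F.contMDiff g).mdifferentiableAt (by simp)).hasMFDerivAt
    exact DFunLike.congr_fun (h1.const_smul c).mfderiv (𝒢.leftInvariantField X g)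

theorem leftInvariantOp_mul (X : 𝒢.algebroidSections) (F K : C^∞⟮𝓘(ℝ, E₁), G; ℝ⟯) :
    leftInvariantOp X (F * K) = F * leftInvariantOp X K + leftInvariantOp X F * K := by
  refine ContMDiffMap.ext fun g => ?_
  have h1 := ((F.contMDiff g).mdifferentiableAt (by simp)).hasMFDerivAt
  have h2 := ((K.contMDiff g).mdifferentiableAt (by simp)).hasMFDerivAt
  have := DFunLike.congr_fun (h1.mul h2).mfderiv (𝒢.leftInvariantField X g)
  refine Eq.trans this ?_
  exact congrArg (F g * act (𝒢.leftInvariantField X) K g + ·)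
    (mul_comm (K g) (act (𝒢.leftInvariantField X) F g))

theorem leftInvariantOp_add (X Y : 𝒢.algebroidSections) :
    leftInvariantOp (X + Y) = leftInvariantOp X + leftInvariantOp Y :=
  LinearMap.ext fun F => ContMDiffMap.ext fun g => by
    have h1 : 𝒢.leftInvariantField (X + Y : 𝒢.algebroidSections) g =
      𝒢.leftInvariantField X g + 𝒢.leftInvariantField Y g := map_add _ _ _
    exact (congrArg (mfderiv 𝓘(ℝ, E₁) 𝓘(ℝ) F g) h1).trans (map_add _ _ _)

theorem leftInvariantOp_smul (f : C^∞⟮𝓘(ℝ, E₀), M; ℝ⟯) (X : 𝒢.algebroidSections)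
    (F : C^∞⟮𝓘(ℝ, E₁), G; ℝ⟯) :
    leftInvariantOp (f • X) F = 𝒢.sourcePullback f * leftInvariantOp X F :=
  ContMDiffMap.ext fun g => by
    have h1 : 𝒢.leftInvariantField (f • X : 𝒢.algebroidSections) g =
      f (𝒢.source g) • 𝒢.leftInvariantField X g := map_smul _ _ _
    exact (congrArg (mfderiv 𝓘(ℝ, E₁) 𝓘(ℝ) F g) h1).trans (map_smul _ _ _)

theorem leftInvariantOp_smul' (c : ℝ) (X : 𝒢.algebroidSections) :
    leftInvariantOp (c • X) = c • leftInvariantOp X :=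
  LinearMap.ext fun F => ContMDiffMap.ext fun g => by
    have h1 : 𝒢.leftInvariantField (c • X : 𝒢.algebroidSections) g =
      c • 𝒢.leftInvariantField X g := map_smul _ _ _
    exact (congrArg (mfderiv 𝓘(ℝ, E₁) 𝓘(ℝ) F g) h1).trans (map_smul _ _ _)

variable [FiniteDimensional ℝ E₁] [T2Space G]

theorem leftInvariantOp_injective :
    Function.Injective (leftInvariantOp : 𝒢.algebroidSections → _) := fun X Y h =>
  Subtype.ext <| funext fun x => tangent_ext fun F => by
    have h1 : act (𝒢.leftInvariantField X) F (𝒢.unit x) =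
      act (𝒢.leftInvariantField Y) F (𝒢.unit x) := DFunLike.congr_fun (LinearMap.congr_fun h F) _
    rwa [𝒢.leftInvariantField_unit X.2 F.contMDiff, 𝒢.leftInvariantField_unit Y.2 F.contMDiff] at h1

variable [FiniteDimensional ℝ E₀] [T2Space M]

/-- The Lie bracket on the sections of `𝔤`. -/
noncomputable instance : Bracket 𝒢.algebroidSections 𝒢.algebroidSections where
  bracket X Y := ⟨𝒢.bracketSection X Y, 𝒢.bracketSection_mem X.2 Y.2⟩

theorem leftInvariantOp_lie (X Y : 𝒢.algebroidSections) (F : C^∞⟮𝓘(ℝ, E₁), G; ℝ⟯) :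
    leftInvariantOp ⁅X, Y⁆ F =
      leftInvariantOp X (leftInvariantOp Y F) - leftInvariantOp Y (leftInvariantOp X F) :=
  ContMDiffMap.ext fun g => 𝒢.act_lie X.2 Y.2 F.contMDiff g

/-- The sections of `𝔤` form a Lie algebra over `ℝ`. -/
noncomputable instance : LieRing 𝒢.algebroidSections where
  add_lie X Y Z := leftInvariantOp_injective <| LinearMap.ext fun F => by
    simp only [leftInvariantOp_add, leftInvariantOp_lie, LinearMap.add_apply, map_add]; abel
  lie_add X Y Z := leftInvariantOp_injective <| LinearMap.ext fun F => by
    simp only [leftInvariantOp_add, leftInvariantOp_lie, LinearMap.add_apply, map_add]; abel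
  lie_self X := leftInvariantOp_injective <| LinearMap.ext fun F => by
    have : leftInvariantOp (0 : 𝒢.algebroidSections) = 0 := by
      have := leftInvariantOp_smul' (0 : ℝ) (0 : 𝒢.algebroidSections)
      rwa [zero_smul, zero_smul] at this
    rw [leftInvariantOp_lie, sub_self, this, LinearMap.zero_apply]
  leibniz_lie X Y Z := leftInvariantOp_injective <| LinearMap.ext fun F => by
    simp only [leftInvariantOp_add, leftInvariantOp_lie, LinearMap.add_apply, map_sub]; abel

noncomputable instance : LieAlgebra ℝ 𝒢.algebroidSections where
  lie_smul c X Y := leftInvariantOp_injective <| LinearMap.ext fun F => by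
    simp only [leftInvariantOp_smul', leftInvariantOp_lie, LinearMap.smul_apply, map_smul, smul_sub]

/-- The anchor of `𝔤` is the restriction of `ds : TG → TM`: for a section `X` of `𝔤` and
`f ∈ C^∞(M)`, the function `X(f) = ⁅X, f⁆` is given by `X(f)(x) = df (ds (X x))`. -/
noncomputable instance : Bracket 𝒢.algebroidSections C^∞⟮𝓘(ℝ, E₀), M; ℝ⟯ where
  bracket X f := ⟨fun x => (mfderiv 𝓘(ℝ, E₀) 𝓘(ℝ) f (𝒢.source (𝒢.unit x))
      (mfderiv 𝓘(ℝ, E₁) 𝓘(ℝ, E₀) 𝒢.source (𝒢.unit x) (X.1 x)) : ℝ), by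
    have h1 : ContMDiff 𝓘(ℝ, E₁) 𝓘(ℝ) ∞ (f ∘ 𝒢.source) := f.contMDiff.comp 𝒢.contMDiff_source
    have h2 := (contMDiff_act (𝒢.contMDiff_leftInvariantField X.2) h1).comp 𝒢.contMDiff_unit
    refine h2.congr fun x => ?_
    have d1 : HasMFDerivAt 𝓘(ℝ, E₀) 𝓘(ℝ) f (𝒢.source (𝒢.unit x)) _ :=
      ((f.contMDiff _).mdifferentiableAt (by simp)).hasMFDerivAt
    have d2 := ((𝒢.contMDiff_source (𝒢.unit x)).mdifferentiableAt (by simp)).hasMFDerivAt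
    have d3 := DFunLike.congr_fun (d1.comp _ d2).mfderiv (X.1 x)
    exact ((𝒢.leftInvariantField_unit X.2 h1 x).trans d3).symm⟩

theorem leftInvariantOp_sourcePullback (X : 𝒢.algebroidSections) (f : C^∞⟮𝓘(ℝ, E₀), M; ℝ⟯) :
    leftInvariantOp X (𝒢.sourcePullback f) = 𝒢.sourcePullback ⁅X, f⁆ := by
  refine ContMDiffMap.ext fun g => (𝒢.act_comp_source X.2 f.contMDiff g).trans ?_
  have h1 : ContMDiff 𝓘(ℝ, E₁) 𝓘(ℝ) ∞ (f ∘ 𝒢.source) := f.contMDiff.comp 𝒢.contMDiff_source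
  have d1 : HasMFDerivAt 𝓘(ℝ, E₀) 𝓘(ℝ) f (𝒢.source (𝒢.unit (𝒢.source g))) _ :=
    ((f.contMDiff _).mdifferentiableAt (by simp)).hasMFDerivAt
  have d2 := ((𝒢.contMDiff_source (𝒢.unit (𝒢.source g))).mdifferentiableAt (by simp)).hasMFDerivAt
  have d3 := DFunLike.congr_fun (d1.comp _ d2).mfderiv (X.1 (𝒢.source g))
  exact (𝒢.leftInvariantField_unit X.2 h1 (𝒢.source g)).trans d3

noncomputable instance : LieRingModule 𝒢.algebroidSections C^∞⟮𝓘(ℝ, E₀), M; ℝ⟯ where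
  add_lie X Y f := (sourcePullback_injective (𝒢 := 𝒢)) <| by
    simp only [map_add, ← leftInvariantOp_sourcePullback, leftInvariantOp_add, LinearMap.add_apply]
  lie_add X f h := (sourcePullback_injective (𝒢 := 𝒢)) <| by
    simp only [map_add, ← leftInvariantOp_sourcePullback]
  leibniz_lie X Y f := (sourcePullback_injective (𝒢 := 𝒢)) <| by
    simp only [map_add, ← leftInvariantOp_sourcePullback, leftInvariantOp_lie]; abel

/-- `(C^∞(M), Γ(𝔤))` is a Lie-Rinehart algebra over `ℝ`. -/
instance : LieRinehartRing C^∞⟮𝓘(ℝ, E₀), M; ℝ⟯ 𝒢.algebroidSections where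
  lie_smul_eq_mul' f h X := (sourcePullback_injective (𝒢 := 𝒢)) <| by
    simp only [map_mul, ← leftInvariantOp_sourcePullback, leftInvariantOp_smul]
  leibniz_mul_right' X f h := (sourcePullback_injective (𝒢 := 𝒢)) <| by
    simp only [map_mul, map_add, smul_eq_mul, ← leftInvariantOp_sourcePullback, leftInvariantOp_mul]
  leibniz_smul_right' X Y f := leftInvariantOp_injective <| LinearMap.ext fun F => by
    simp only [leftInvariantOp_add, leftInvariantOp_lie, leftInvariantOp_smul, leftInvariantOp_mul,
      leftInvariantOp_sourcePullback, LinearMap.add_apply]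
    ring

instance : LieRinehartAlgebra ℝ C^∞⟮𝓘(ℝ, E₀), M; ℝ⟯ 𝒢.algebroidSections where
  smul_lie c X f := (sourcePullback_injective (𝒢 := 𝒢)) <| by
    simp only [map_smul, ← leftInvariantOp_sourcePullback, leftInvariantOp_smul',
      LinearMap.smul_apply]
  lie_smul c X f := (sourcePullback_injective (𝒢 := 𝒢)) <| by
    simp only [map_smul, ← leftInvariantOp_sourcePullback]

variable (𝒢) in
/-- The universal enveloping algebra `𝓤(𝔤) = 𝓤(C^∞(M), Γ(𝔤))`. -/
abbrev Enveloping : Type _ := LieRinehart.Env ℝ C^∞⟮𝓘(ℝ, E₀), M; ℝ⟯ 𝒢.algebroidSections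

variable (𝒢) in
/-- The representation `Ω : 𝓤(𝔤) → End(C^∞(G))`, which maps `f ∈ C^∞(M)` to the multiplication by
`f ∘ s` and a section `X` of `𝔤` to the left-invariant vector field `X̄`. Its image is the algebra of
left-invariant differential operators on `𝒢`. -/
noncomputable def Ω : 𝒢.Enveloping →ₐ[ℝ] Module.End ℝ C^∞⟮𝓘(ℝ, E₁), G; ℝ⟯ :=
  LieRinehart.Env.lift
    ((Algebra.lmul ℝ C^∞⟮𝓘(ℝ, E₁), G; ℝ⟯).comp 𝒢.sourcePullback)
    { toFun := leftInvariantOp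
      map_add' := leftInvariantOp_add
      map_smul' := leftInvariantOp_smul' }
    (fun X Y => LinearMap.ext fun F => leftInvariantOp_lie X Y F)
    (fun f X => LinearMap.ext fun F => leftInvariantOp_smul f X F)
    (fun X f => LinearMap.ext fun F => by
      have := leftInvariantOp_mul X (𝒢.sourcePullback f) F
      rw [leftInvariantOp_sourcePullback] at this
      exact eq_sub_of_add_eq' this.symm)

end LieGroupoid

/-- The ideal `N_p(C^∞(N))` of the smooth functions on `N` whose germ at `p` is zero. -/
def germIdeal {E : Type*} [NormedAddCommGroup E] [NormedSpace ℝ E] {N : Type*} [TopologicalSpace N]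
    [ChartedSpace E N] (p : N) : Ideal C^∞⟮𝓘(ℝ, E), N; ℝ⟯ where
  carrier := {f | (f : N → ℝ) =ᶠ[𝓝 p] 0}
  add_mem' {f h} hf hh := by
    filter_upwards [hf, hh] with q h1 h2
    change f q + h q = 0
    simp_all
  zero_mem' := Filter.EventuallyEq.rfl
  smul_mem' f h hh := by
    filter_upwards [hh] with q h1
    change f q * h q = 0
    simp_all

/-- The algebra `C^∞(N)_p = C^∞(N) / N_p(C^∞(N))` of germs at `p` of smooth functions on `N`. -/
abbrev SmoothGerm (E : Type*) [NormedAddCommGroup E] [NormedSpace ℝ E] {N : Type*}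
    [TopologicalSpace N] [ChartedSpace E N] (p : N) : Type _ :=
  C^∞⟮𝓘(ℝ, E), N; ℝ⟯ ⧸ germIdeal (E := E) p

namespace LieGroupoid
open Aux Set Filter VectorField

variable {E₀ M E₁ G : Type*} [NormedAddCommGroup E₀] [NormedSpace ℝ E₀]
  [TopologicalSpace M] [ChartedSpace E₀ M]
  [NormedAddCommGroup E₁] [NormedSpace ℝ E₁] [TopologicalSpace G] [ChartedSpace E₁ G]
  [IsManifold 𝓘(ℝ, E₁) ∞ G] [IsManifold 𝓘(ℝ, E₀) ∞ M]
  [FiniteDimensional ℝ E₁] [T2Space G] [FiniteDimensional ℝ E₀] [T2Space M]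
  (𝒢 : LieGroupoid E₀ M E₁ G)

variable {𝒢} in
theorem lie_mem_germIdeal (x : M) (X : 𝒢.algebroidSections) :
    ∀ f ∈ germIdeal (E := E₀) x, ⁅X, f⁆ ∈ germIdeal (E := E₀) x := fun f hf => by
  filter_upwards [eventually_eventually_nhds.2 hf] with y hy
  have hy : (f : M → ℝ) =ᶠ[𝓝 (𝒢.source (𝒢.unit y))] fun _ => 0 := by rw [𝒢.source_unit]; exact hy
  have := mfderiv_eq_of_eventuallyEq hy (mfderiv 𝓘(ℝ, E₁) 𝓘(ℝ, E₀) 𝒢.source (𝒢.unit y) (X.1 y))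
  refine Eq.trans this ?_
  rw [mfderiv_const]; rfl

/-- The localization `𝓤(𝔤)_x = 𝓤(𝔤) / N_x(𝓤(𝔤))`, with `N_x(𝓤(𝔤)) = N_x(C^∞(M)) 𝓤(𝔤)`, of the
left `C^∞(M)`-module `𝓤(𝔤)`. As `N_x(𝓤(𝔤))` is a two-sided ideal, it is an algebra. -/
abbrev EnvelopingAt (x : M) : Type _ :=
  𝒢.Enveloping ⧸ LieRinehart.Env.smulIdeal ℝ 𝒢.algebroidSections (germIdeal (E := E₀) x)
    (lie_mem_germIdeal x)
end LieGroupoid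

/-!
The operators `Ω u` are local, that is, they do not increase supports: this holds for
multiplications and for vector fields, which generate their algebra (`LieGroupoid.Ω_mem_germIdeal`).
So they descend to germs at `g`, where they still form a representation of `𝓤(𝔤)`
(`AlgHom.exists_descend`). If `f ∈ C^∞(M)` vanishes near `x = s(g)`, then `f ∘ s` vanishes near `g` as
`s` is continuous; since `Ω (f u) F = (f ∘ s) Ω u F`, the representation on germs vanishes on
`N_x 𝓤(𝔤)` (`LieGroupoid.Ω_smulIdeal_mem_germIdeal`) and factors through `𝓤(𝔤)_x`. Uniqueness holds
because every element of `𝓤(𝔤)_x` is a class and every germ is that of a global function.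
-/

/-- A representation whose operators preserve the kernel of a surjective linear map `π : V → W`
descends to a representation on `W`. -/
theorem AlgHom.exists_descend {k U V W : Type*} [CommRing k] [Ring U] [Algebra k U]
    [AddCommGroup V] [Module k V] [AddCommGroup W] [Module k W]
    (Φ : U →ₐ[k] Module.End k V) (π : V →ₗ[k] W) (hπ : Function.Surjective π)
    (hker : ∀ u v, π v = 0 → π (Φ u v) = 0) :
    ∃ ρ : U →ₐ[k] Module.End k W, ∀ u v, ρ u (π v) = π (Φ u v) := by
  have hσ := Function.rightInverse_surjInv hπ
  set σ := Function.surjInv hπ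
  -- `π (Φ u v)` depends only on `π v`, so the choice of the section `σ` is immaterial.
  have key : ∀ u v v', π v = π v' → π (Φ u v) = π (Φ u v') := fun u v v' h => by
    have := hker u (v - v') (by rw [map_sub, h, sub_self])
    rwa [map_sub, map_sub, sub_eq_zero] at this
  let T : U → Module.End k W := fun u =>
    { toFun := fun w => π (Φ u (σ w))
      map_add' := fun w w' => by
        rw [← map_add, ← map_add]
        exact key _ _ _ (by rw [map_add, hσ, hσ, hσ])
      map_smul' := fun c w => by
        rw [RingHom.id_apply, ← map_smul, ← map_smul]
        exact key _ _ _ (by rw [map_smul, hσ, hσ]) }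
  have hT : ∀ u v, T u (π v) = π (Φ u v) := fun u v => key _ _ _ (hσ _)
  have hext : ∀ A B : Module.End k W, (∀ v, A (π v) = B (π v)) → A = B := fun A B h =>
    LinearMap.ext fun w => by obtain ⟨v, rfl⟩ := hπ w; exact h v
  refine ⟨AlgHom.ofLinearMap ⟨⟨T, fun u u' => hext _ _ fun v => ?_⟩,
    fun c u => hext _ _ fun v => ?_⟩ (hext _ _ fun v => ?_) (fun u u' => hext _ _ fun v => ?_), hT⟩
  · simp [hT]
  · simp [hT]
  · change T 1 (π v) = π v
    simp [hT]
  · change T (u * u') (π v) = T u (T u' (π v))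
    simp [hT]

namespace LieGroupoid

open Aux Filter

variable {E₀ M E₁ G : Type*}
  [NormedAddCommGroup E₀] [NormedSpace ℝ E₀] [FiniteDimensional ℝ E₀]
  [TopologicalSpace M] [ChartedSpace E₀ M] [IsManifold 𝓘(ℝ, E₀) ∞ M] [T2Space M]
  [NormedAddCommGroup E₁] [NormedSpace ℝ E₁] [FiniteDimensional ℝ E₁]
  [TopologicalSpace G] [ChartedSpace E₁ G] [IsManifold 𝓘(ℝ, E₁) ∞ G] [T2Space G]
  {𝒢 : LieGroupoid E₀ M E₁ G}

theorem Ω_ofAlg (f : C^∞⟮𝓘(ℝ, E₀), M; ℝ⟯) (F : C^∞⟮𝓘(ℝ, E₁), G; ℝ⟯) :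
    𝒢.Ω (LieRinehart.Env.ofAlg ℝ _ _ f) F = 𝒢.sourcePullback f * F := by
  rw [Ω, LieRinehart.Env.lift_ofAlg]; rfl

theorem Ω_ofLie (X : 𝒢.algebroidSections) : 𝒢.Ω (LieRinehart.Env.ofLie ℝ _ _ X) =
    leftInvariantOp X := by
  rw [Ω, LieRinehart.Env.lift_ofLie]; rfl

theorem leftInvariantOp_mem_germIdeal (X : 𝒢.algebroidSections) {g : G}
    {F : C^∞⟮𝓘(ℝ, E₁), G; ℝ⟯} (hF : F ∈ germIdeal (E := E₁) g) :
    leftInvariantOp X F ∈ germIdeal (E := E₁) g := by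
  filter_upwards [eventually_eventually_nhds.2 hF] with h hh
  have hh : (F : G → ℝ) =ᶠ[𝓝 h] fun _ => 0 := hh
  refine (mfderiv_eq_of_eventuallyEq hh (𝒢.leftInvariantField X h)).trans ?_
  rw [mfderiv_const]; rfl

theorem Ω_mem_germIdeal (u : 𝒢.Enveloping) {g : G} {F : C^∞⟮𝓘(ℝ, E₁), G; ℝ⟯}
    (hF : F ∈ germIdeal (E := E₁) g) : 𝒢.Ω u F ∈ germIdeal (E := E₁) g := by
  induction u using LieRinehart.Env.induction generalizing F with
  | hA f => rw [Ω_ofAlg]; exact Ideal.mul_mem_left _ _ hF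
  | hL X => rw [Ω_ofLie]; exact leftInvariantOp_mem_germIdeal X hF
  | hadd u v hu hv => rw [map_add]; exact add_mem (hu hF) (hv hF)
  | hmul u v hu hv => rw [map_mul]; exact hu (hv hF)

theorem sourcePullback_mem_germIdeal {g : G} {f : C^∞⟮𝓘(ℝ, E₀), M; ℝ⟯}
    (hf : f ∈ germIdeal (E := E₀) (𝒢.source g)) :
    𝒢.sourcePullback f ∈ germIdeal (E := E₁) g :=
  𝒢.contMDiff_source.continuous.continuousAt.eventually hf

theorem Ω_smulIdeal_mem_germIdeal {g : G} {u : 𝒢.Enveloping}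
    (hu : u ∈ LieRinehart.Env.smulIdeal ℝ 𝒢.algebroidSections
      (germIdeal (E := E₀) (𝒢.source g)) (lie_mem_germIdeal _))
    (F : C^∞⟮𝓘(ℝ, E₁), G; ℝ⟯) : 𝒢.Ω u F ∈ germIdeal (E := E₁) g := by
  change u ∈ germIdeal (E := E₀) (𝒢.source g) •
    (⊤ : Submodule C^∞⟮𝓘(ℝ, E₀), M; ℝ⟯ 𝒢.Enveloping) at hu
  induction hu using Submodule.smul_induction_on' with
  | smul f hf v _ =>
    rw [LieRinehart.Env.smul_def, map_mul, Module.End.mul_apply, Ω_ofAlg]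
    exact Ideal.mul_mem_right _ _ (sourcePullback_mem_germIdeal hf)
  | add _ _ _ _ h1 h2 => rw [map_add]; exact add_mem h1 h2

end LieGroupoid

theorem mainTheorem8 {E₀ M E₁ G : Type*}
    [NormedAddCommGroup E₀] [NormedSpace ℝ E₀] [FiniteDimensional ℝ E₀]
    [TopologicalSpace M] [ChartedSpace E₀ M] [IsManifold 𝓘(ℝ, E₀) ∞ M] [T2Space M]
    [ParacompactSpace M]
    [NormedAddCommGroup E₁] [NormedSpace ℝ E₁] [FiniteDimensional ℝ E₁]
    [TopologicalSpace G] [ChartedSpace E₁ G] [IsManifold 𝓘(ℝ, E₁) ∞ G] [T2Space G]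
    [ParacompactSpace G]
    (𝒢 : LieGroupoid E₀ M E₁ G) (x : M) (g : G) (hg : 𝒢.source g = x) :
    ∃! ρ : 𝒢.EnvelopingAt x →ₐ[ℝ] Module.End ℝ (SmoothGerm E₁ g),
      ∀ (u : 𝒢.Enveloping) (F : C^∞⟮𝓘(ℝ, E₁), G; ℝ⟯),
        ρ (Ideal.Quotient.mk _ u) (Ideal.Quotient.mk _ F) = Ideal.Quotient.mk _ (𝒢.Ω u F) := by
  subst hg
  obtain ⟨ρ, hρ⟩ := 𝒢.Ω.exists_descend (Ideal.Quotient.mkₐ ℝ (germIdeal (E := E₁) g)).toLinearMap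
    Ideal.Quotient.mk_surjective fun u F hF =>
      Ideal.Quotient.eq_zero_iff_mem.2
        (LieGroupoid.Ω_mem_germIdeal u (Ideal.Quotient.eq_zero_iff_mem.1 hF))
  refine ⟨Ideal.Quotient.liftₐ _ ρ fun u hu => LinearMap.ext fun w => ?_, fun u F => hρ u F,
    fun ρ' hρ' => ?_⟩
  · obtain ⟨F, rfl⟩ := Ideal.Quotient.mk_surjective w
    exact (hρ u F).trans
      (Ideal.Quotient.eq_zero_iff_mem.2 (LieGroupoid.Ω_smulIdeal_mem_germIdeal hu F))
  · refine AlgHom.ext fun a => LinearMap.ext fun w => ?_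
    obtain ⟨u, rfl⟩ := Ideal.Quotient.mk_surjective a
    obtain ⟨F, rfl⟩ := Ideal.Quotient.mk_surjective w
    exact (hρ' u F).trans (hρ u F).symm
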